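/- Let $k\ge 2$ and let $\mathcal C$ be a nonempty set of $k$-ary Boolean constraint templates (relations $R\subseteq\{0,1\}^k$). For a variable $x$ write $x^{1}=x$, $x^{-1}=\overline{x}$. The set $\mathcal C$ is called *good* if all the relations $R(x_1^{\epsilon_1},\dots,x_k^{\epsilon_k})$ with $R\in\mathcal C$ and $\epsilon\in\{\pm1\}^k$ are distinct, i.e. there are $|\mathcal C|\,2^k$ of them. A *constraint* on $n$ variables consists of an ordered list of $k$ distinct variables, each of them possibly negated, and a template $R\in\mathcal C$ applied to the resulting list of literals; a *formula* is a finite set of constraints. A random instance of $\mathrm{SAT}^{(\mathrm{neg})}(\mathcal C)$ with $n$ variables and $m$ constraints is generated by choosing $m$ hyperedges of the complete $k$-uniform hypergraph on the $n$ variables, independently, uniformly and with replacement, and for each of them, independently, a uniformly random ordering of its variables, an independent negation of each variable with probability $1/2$, and a uniformly random template of $\mathcal C$, which is applied to the resulting list of literals. "With high probability" (w.h.p.) means with probability tending to $1$ as $n\to\infty$. A formula is *minimally unsatisfiable* if it is unsatisfiable and each of its proper subformulas is satisfiable. $\mathrm{SAT}^{(\mathrm{neg})}(\mathcal C)$ has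 a *sharp threshold* if for every $0<\epsilon<1/2$ we have $\lim_{n\to\infty}\frac{p_{1-\epsilon}(n)-p_\epsilon(n)}{p_{1/2}(n)}=0$, where $p_\epsilon(n)$ is the probability $p$ for which the random formula that contains each possible constraint on $n$ variables independently with probability $p$ is unsatisfiable with probability $\epsilon$. The *spine* $S(\Phi)$ of a formula $\Phi$ on $n$ variables is the set of variables $x$ that appear in $\Phi$ and for which there are a subformula $\Xi\subseteq\Phi$ and a constraint $C$ on the $n$ variables that contains $x$, such that $\Xi$ is satisfiable and $\Xi\cup\{C\}$ is not. $\mathrm{SAT}^{(\mathrm{neg})}(\mathcal C)$ has a *discontinuous spine* if there is $\eta>0$ such that for every sequence $m=m(n)$: if random instances $\Phi$ with $m(n)$ constraints are satisfiable with probability tending to $0$, then $|S(\Phi)|/n\ge\eta$ w.h.p. Given a way to write each template of $\mathcal C$ as an equivalent conjunction of clauses, let $Cl(\Phi)$ be the CNF formula obtained by writing each constraint of $\Phi$ accordingly. The *resolution complexity* of $\Phi$ is the length of the shortest resolution refutation of $Cl(\Phi)$ ($\infty$ if $\Phi$ is satisfiable). $\mathrm{SAT}^{(\mathrm{neg})}(\mathcal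 C)$ has *exponential resolution complexity* if, for each such way of writing the templates and every $c>0$, there is $\eta>0$ such that for every sequence $m(n)\le cn$ random instances with $m(n)$ constraints have resolution complexity at least $2^{\eta n}$ w.h.p. **Theorem.** Let $\mathcal C$ be good and such that 1. $\mathrm{SAT}^{(\mathrm{neg})}(\mathcal C)$ has a sharp threshold; 2. there is $\epsilon>0$ such that for every minimally unsatisfiable formula $F$ (on any number of variables), the ratio of the number of constraints in $F$ to the number of distinct literals (variables and negated variables) appearing in $F$ is at least $\frac{1+\epsilon}{k-1}$. Then 1. there is $\delta>0$ such that for every sequence $m(n)\le \frac{2}{k(k-1)}(1+\delta)\,n$, random instances of $\mathrm{SAT}^{(\mathrm{neg})}(\mathcal C)$ with $m(n)$ constraints are satisfiable w.h.p.; 2. $\mathrm{SAT}^{(\mathrm{neg})}(\mathcal C)$ has a discontinuous spine and exponential resolution complexity. -/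

import Mathlib

namespace NegSAT

/-- A `k`-ary Boolean constraint template (relation): the set of its satisfying value tuples. -/
abbrev Template (k : ℕ) := Finset (Fin k → Bool)

/-- A literal over `n` variables: `(v, true)` is the variable `v`, `(v, false)` its negation. -/
abbrev Literal (n : ℕ) := Fin n × Bool

/-- The value of a literal under an assignment. -/
def litVal {n : ℕ} (a : Fin n → Bool) (l : Literal n) : Bool := a l.1 == l.2

/-- The template `R (x₁^{e₁}, …, x_k^{e_k})`. -/
def negate {k : ℕ} (R : Template k) (e : Fin k → Bool) : Template k :=
  Finset.univ.filter fun x => (fun i => x i == e i) ∈ R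

/-- The closure of a template set under negating arguments. -/
def closure {k : ℕ} (𝒞 : Finset (Template k)) : Finset (Template k) :=
  (𝒞 ×ˢ (Finset.univ : Finset (Fin k → Bool))).image fun q => negate q.1 q.2

/-- `𝒞` is good: all the templates `R (x₁^{e₁}, …, x_k^{e_k})`, `R ∈ 𝒞`, are distinct. -/
def Good {k : ℕ} (𝒞 : Finset (Template k)) : Prop :=
  (closure 𝒞).card = 𝒞.card * 2 ^ k

/-- A constraint on `n` variables: an ordered list of `k` distinct variables, a sign for each
position, and a template from `𝒞`, which is applied to the resulting list of literals.
A uniformly random element of this type is a uniformly random hyperedge of the complete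
`k`-uniform hypergraph with a uniformly random ordering, independent fair signs and a uniformly
random template. -/
abbrev Constr {k : ℕ} (𝒞 : Finset (Template k)) (n : ℕ) :=
  (Fin k ↪ Fin n) × (Fin k → Bool) × {R : Template k // R ∈ 𝒞}

/-- A formula is a finite set of constraints. -/
abbrev Formula {k : ℕ} (𝒞 : Finset (Template k)) (n : ℕ) := Finset (Constr 𝒞 n)

section Formulas

variable {k : ℕ} {𝒞 : Finset (Template k)} {n : ℕ}

/-- The `i`-th literal of a constraint. -/
def Constr.lit (c : Constr 𝒞 n) (i : Fin k) : Literal n := (c.1 i, c.2.1 i)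

/-- The assignment `a` satisfies the constraint `c`. -/
def Constr.SatBy (c : Constr 𝒞 n) (a : Fin n → Bool) : Prop :=
  (fun i => litVal a (Constr.lit c i)) ∈ c.2.2.1

/-- The set of variables of a constraint. -/
def Constr.vars (c : Constr 𝒞 n) : Finset (Fin n) :=
  Finset.univ.image fun i => c.1 i

/-- The set of variables that appear in a formula. -/
def Formula.vars (Φ : Formula 𝒞 n) : Finset (Fin n) :=
  Φ.biUnion fun c => Constr.vars c

/-- The set of distinct literals that appear in a formula. -/
def Formula.lits (Φ : Formula 𝒞 n) : Finset (Literal n) :=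
  Φ.biUnion fun c => Finset.univ.image fun i => Constr.lit c i

/-- The formula is satisfiable. -/
def Formula.Sat (Φ : Formula 𝒞 n) : Prop :=
  ∃ a : Fin n → Bool, ∀ c ∈ Φ, Constr.SatBy c a

/-- The formula is unsatisfiable, and all its proper subformulas are satisfiable. -/
def Formula.MinUnsat (Φ : Formula 𝒞 n) : Prop :=
  ¬ Formula.Sat Φ ∧ ∀ Ξ : Formula 𝒞 n, Ξ ⊂ Φ → Formula.Sat Ξ

open Classical in
/-- The spine of `Φ`: the variables `x` of `Φ` such that some possible constraint `c` that
contains `x` makes a satisfiable subformula of `Φ` unsatisfiable. -/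
noncomputable def Formula.spine (Φ : Formula 𝒞 n) : Finset (Fin n) :=
  (Formula.vars Φ).filter fun x =>
    ∃ (c : Constr 𝒞 n) (Ξ : Formula 𝒞 n), x ∈ Constr.vars c ∧ Ξ ⊆ Φ ∧
      Formula.Sat Ξ ∧ ¬ Formula.Sat (insert c Ξ)

/-- The spine fraction. -/
noncomputable def Formula.spineFraction (Φ : Formula 𝒞 n) : ℝ :=
  ((Formula.spine Φ).card : ℝ) / n

end Formulas

section Models

variable {k : ℕ} (𝒞 : Finset (Template k))

open Classical in
/-- Counting model: the probability of the property `A` for the random formula that consists of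
`m` constraints drawn independently and uniformly, with replacement. -/
noncomputable def prob (n m : ℕ) (A : Formula 𝒞 n → Prop) : ℝ :=
  ((Finset.univ.filter fun ω : Fin m → Constr 𝒞 n => A (Finset.univ.image ω)).card : ℝ) /
    Fintype.card (Fin m → Constr 𝒞 n)

open Classical in
/-- Constant probability model: the probability of the property `A` for the random formula that
contains each possible constraint independently with probability `p`. -/
noncomputable def biasedProb (n : ℕ) (p : ℝ) (A : Formula 𝒞 n → Prop) : ℝ :=
  ∑ Φ ∈ Finset.univ.filter (fun Φ : Formula 𝒞 n => A Φ),
    p ^ Φ.card * (1 - p) ^ (Fintype.card (Constr 𝒞 n) - Φ.card)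

/-- The probability `p_ε(n)` at which a random formula of the constant probability model is
unsatisfiable with probability `ε`. (When `n ≥ k ≥ 1` and `𝒞` is good and nonempty, the
probability of unsatisfiability increases continuously and strictly from `0` at `p = 0` to `1`
at `p = 1`, so the infimum is the unique solution of the equation.) -/
noncomputable def critProb (n : ℕ) (ε : ℝ) : ℝ :=
  sInf {p : ℝ | 0 ≤ p ∧ p ≤ 1 ∧ ε ≤ biasedProb 𝒞 n p fun Φ => ¬ Formula.Sat Φ}

/-- Unsatisfiability has a sharp threshold. -/
def SharpThreshold : Prop :=
  ∀ ε : ℝ, 0 < ε → ε < 1 / 2 →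
    Filter.Tendsto
      (fun n : ℕ => (critProb 𝒞 n (1 - ε) - critProb 𝒞 n ε) / critProb 𝒞 n (1 / 2))
      Filter.atTop (nhds 0)

/-- The spine is discontinuous: there is `η > 0` such that, whenever random formulas with `m(n)`
constraints are unsatisfiable with high probability, their spine fraction is at least `η` with
high probability. -/
def DiscontinuousSpine : Prop :=
  ∃ η : ℝ, 0 < η ∧ ∀ m : ℕ → ℕ,
    Filter.Tendsto (fun n => prob 𝒞 n (m n) fun Φ => Formula.Sat Φ) Filter.atTop (nhds 0) →
    Filter.Tendsto (fun n => prob 𝒞 n (m n) fun Φ => η ≤ Formula.spineFraction Φ)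
      Filter.atTop (nhds 1)

end Models

section Resolution

/-- A clause (disjunction) over `n` variables, as the set of its literals. -/
abbrev Clause (n : ℕ) := Finset (Literal n)

/-- `E` is the resolvent of `C` and `D` on the variable `v`. -/
def IsResolvent {n : ℕ} (C D E : Clause n) : Prop :=
  ∃ v : Fin n, (v, true) ∈ C ∧ (v, false) ∈ D ∧
    E = C.erase (v, true) ∪ D.erase (v, false)

/-- The list `π` is a resolution refutation of the clause set `Γ`: each of its clauses belongs
to `Γ` or is the resolvent of two earlier clauses, and the empty clause occurs in it. -/
def IsRefutation {n : ℕ} (Γ : Finset (Clause n)) (π : List (Clause n)) : Prop :=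
  (∀ i : Fin π.length, π.get i ∈ Γ ∨
    ∃ j l : Fin π.length, j < i ∧ l < i ∧ IsResolvent (π.get j) (π.get l) (π.get i)) ∧
  ∅ ∈ π

/-- The length of the shortest resolution refutation (`⊤` if there is none). -/
noncomputable def resolutionComplexity {n : ℕ} (Γ : Finset (Clause n)) : ℕ∞ :=
  ⨅ (π : List (Clause n)) (_ : IsRefutation Γ π), (π.length : ℕ∞)

variable {k : ℕ}

/-- `cl` writes each template in `𝒞` as an equivalent conjunction of clauses, over the argument
positions `0, …, k - 1` as variables. -/
def IsCNFExpression (𝒞 : Finset (Template k)) (cl : Template k → Finset (Clause k)) : Prop :=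
  ∀ R ∈ 𝒞, ∀ x : Fin k → Bool, x ∈ R ↔ ∀ C ∈ cl R, ∃ l ∈ C, litVal x l = true

/-- The literal obtained by substituting the `i`-th literal of `c` for the variable `i` in a
literal over the argument positions. -/
def Constr.substLit {𝒞 : Finset (Template k)} {n : ℕ} (c : Constr 𝒞 n) (l : Literal k) :
    Literal n :=
  (c.1 l.1, l.2 == c.2.1 l.1)

/-- The CNF formula `Cl(Φ)`, when templates are expressed in conjunctive form by `cl`. -/
def Formula.toCNF {𝒞 : Finset (Template k)} {n : ℕ} (cl : Template k → Finset (Clause k))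
    (Φ : Formula 𝒞 n) : Finset (Clause n) :=
  Φ.biUnion fun c => (cl c.2.2.1).image fun C => C.image (Constr.substLit c)

/-- Exponential resolution complexity: however the templates are written in conjunctive form,
for every `c > 0` there is `η > 0` such that random formulas with at most `c n` constraints have,
with high probability, resolution complexity at least `2 ^ (η n)`. -/
def ExponentialResolutionComplexity (𝒞 : Finset (Template k)) : Prop :=
  ∀ cl : Template k → Finset (Clause k), IsCNFExpression 𝒞 cl →
    ∀ c : ℝ, 0 < c → ∃ η : ℝ, 0 < η ∧
      ∀ m : ℕ → ℕ, (∀ n, (m n : ℝ) ≤ c * n) →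
        Filter.Tendsto
          (fun n : ℕ => prob 𝒞 n (m n) fun Φ =>
            ENNReal.ofReal ((2 : ℝ) ^ (η * n)) ≤
              ((resolutionComplexity (Formula.toCNF cl Φ) : ℕ∞) : ENNReal))
          Filter.atTop (nhds 1)

end Resolution

end NegSAT

/-!
All three conclusions follow from first moment estimates, together with the fact that a minimally
unsatisfiable formula is denser, by a factor `1 + ε`, than a hypertree on its literals.

*Sparseness.* For a linear number of random constraints, with high probability every subformula on
`v ≤ η n` variables has at most `(1 + θ) v / (k - 1)` constraints, where `θ < ε`
(`exists_pr_not_sparse_le`). Hence a minimally unsatisfiable subformula has more than `η n`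
variables (`Formula.MinUnsat.lt_card_vars`). Its variables belong to the spine, so the spine is
discontinuous: if there are more than linearly many constraints, then linearly many of them are
already unsatisfiable, and the spine is monotone.

*Satisfiability.* Regard the constraints as hyperedges on the `2 n` literals. Up to the density
`(1 - δ) 2 / (k (k - 1))` this hypergraph is subcritical, that is, the expected number of literals
connected to a given one is at most `1 / δ` (`sum_pr_conn_le`). So the expected number of
hyperedges that close a cycle with earlier ones is bounded (`pr_closesCycle_le`), while the others
form a hyperforest, in which there are at least `k - 1` literals per hyperedge
(`mul_card_le_card_biUnion`). Raising the density to `(1 + δ) 2 / (k (k - 1))` adds only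
`O(δ n)` hyperedges. But an unsatisfiable formula contains a minimally unsatisfiable one, which has
at least `η n` literals, and therefore `ε η n / (k - 1)` hyperedges more than a hyperforest could
have. For small `δ` this is a contradiction.

*Resolution.* If a subformula `Ξ` minimally implies a clause `E`, then adding constraints that
force the literals of `E` to be false makes it unsatisfiable, and all constraints of `Ξ` remain
necessary. Since `𝒞` is good, `2 ^ k` constraints suffice to force a literal (`forcing_iff`). So `Ξ`
is dense up to `O(|E|)` constraints, and by sparseness `|Ξ| = O(|E|)` unless `Ξ` has linear size
(`Formula.Implies.exists_card_le`). In a narrow refutation, the number of constraints needed to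
imply a clause would therefore stay small up to the empty clause, which is impossible
(`Derives.not_empty_of_sparse`). The size-width relation of Ben-Sasson and Wigderson
(`Derives.empty_of_isRefutation`) turns this into an exponential lower bound for the length.
-/

namespace NegSAT

open Finset Filter Topology
open scoped BigOperators

/-! ### Uniform probability on finite product spaces -/

section Averages

variable {Ω α ι : Type*} [Fintype Ω] [Fintype α] [Fintype ι] [DecidableEq ι]

open Classical in
/-- The probability of the event `P` under the uniform distribution on `Ω`. -/
noncomputable def pr (P : Ω → Prop) : ℝ := 𝔼 ω, if P ω then 1 else 0

open Classical in
lemma pr_eq_card_div (P : Ω → Prop) : pr P = (#{ω | P ω} : ℝ) / Fintype.card Ω := by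
  rw [pr, Fintype.expect_eq_sum_div_card, Finset.sum_boole]

lemma pr_nonneg (P : Ω → Prop) : 0 ≤ pr P := by
  classical
  rw [pr_eq_card_div]; positivity

lemma pr_mono {P Q : Ω → Prop} (h : ∀ ω, P ω → Q ω) : pr P ≤ pr Q := by
  classical
  rw [pr_eq_card_div, pr_eq_card_div]
  gcongr with ω
  exact h ω

lemma pr_le_one (P : Ω → Prop) : pr P ≤ 1 := by
  classical
  rw [pr_eq_card_div]
  apply div_le_one_of_le₀ _ (by positivity)
  exact_mod_cast Finset.card_le_univ _

lemma pr_or_le (P Q : Ω → Prop) : pr (fun ω => P ω ∨ Q ω) ≤ pr P + pr Q := by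
  classical
  simp only [pr]
  rw [← Finset.expect_add_distrib]
  refine Finset.expect_le_expect fun ω _ => ?_
  by_cases h1 : P ω <;> by_cases h2 : Q ω <;> simp [h1, h2]

lemma pr_exists_le {β : Type*} (s : Finset β) (P : β → Ω → Prop) :
    pr (fun ω => ∃ b ∈ s, P b ω) ≤ ∑ b ∈ s, pr (P b) := by
  classical
  simp only [pr]
  rw [← Finset.expect_sum_comm]
  refine Finset.expect_le_expect fun ω _ => ?_
  split_ifs with h
  · obtain ⟨b, hb, hP⟩ := h
    calc (1 : ℝ) = if P b ω then 1 else 0 := by simp [hP]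
      _ ≤ _ := Finset.single_le_sum (f := fun b => if P b ω then (1 : ℝ) else 0)
        (fun _ _ => by positivity) hb
  · positivity

lemma pr_not [Nonempty Ω] (P : Ω → Prop) : pr (fun ω => ¬ P ω) = 1 - pr P := by
  classical
  rw [eq_sub_iff_add_eq]
  simp only [pr]
  rw [← Finset.expect_add_distrib]
  refine (Finset.expect_congr rfl fun ω _ => ?_).trans (Finset.expect_const univ_nonempty (1 : ℝ))
  by_cases h : P ω <;> simp [h]

open Classical in
/-- The mean of the number of those events in a family that occur. -/
lemma sum_pr_eq_expect_card {β : Type*} (s : Finset β) (P : β → Ω → Prop) :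
    ∑ b ∈ s, pr (P b) = 𝔼 ω, (#{b ∈ s | P b ω} : ℝ) := by
  simp only [pr]
  rw [← Finset.expect_sum_comm]
  refine Finset.expect_congr rfl fun ω _ => Finset.sum_boole _ _

open Classical in
/-- Markov's inequality for the number of elements of a random set. -/
lemma pr_le_card_div {β : Type*} (s : Finset β) (P : β → Ω → Prop) {t : ℝ} (ht : 0 < t) :
    pr (fun ω => t ≤ (#{b ∈ s | P b ω} : ℝ)) ≤ (∑ b ∈ s, pr (P b)) / t := by
  rw [le_div_iff₀ ht, sum_pr_eq_expect_card, pr, Finset.expect_mul]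
  refine Finset.expect_le_expect fun ω _ => ?_
  split_ifs with h
  · simpa using h
  · simp

/-- Resampling the `j`-th coordinate does not change the uniform distribution, since
`(c, ω) ↦ (ω j, update ω j c)` is an involution. -/
lemma expect_mul_of_update_eq [Nonempty α] (j : ι) (F : α → ℝ) (G : (ι → α) → ℝ)
    (hG : ∀ ω c, G (Function.update ω j c) = G ω) :
    𝔼 ω : ι → α, F (ω j) * G ω = (𝔼 c, F c) * 𝔼 ω, G ω := by
  classical
  let φ : α × (ι → α) → α × (ι → α) := fun p => (p.2 j, Function.update p.2 j p.1)
  have hφ : Function.Involutive φ := by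
    rintro ⟨c, ω⟩
    simp [φ]
  have h1 : ∑ p : α × (ι → α), F (p.2 j) * G p.2 = ∑ p : α × (ι → α), F p.1 * G p.2 := by
    rw [← Equiv.sum_comp hφ.toPerm]
    refine Finset.sum_congr rfl fun p _ => ?_
    change F ((Function.update p.2 j p.1) j) * G (Function.update p.2 j p.1) = _
    rw [hG]; simp
  rw [Fintype.sum_prod_type, Fintype.sum_prod_type] at h1
  simp only [Finset.sum_const, Finset.card_univ, nsmul_eq_mul, ← Finset.mul_sum] at h1
  rw [← Finset.sum_mul] at h1
  rw [Fintype.expect_eq_sum_div_card, Fintype.expect_eq_sum_div_card,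
    Fintype.expect_eq_sum_div_card]
  have hα : (Fintype.card α : ℝ) ≠ 0 := by exact_mod_cast Fintype.card_ne_zero
  have hΩ : (Fintype.card (ι → α) : ℝ) ≠ 0 := by exact_mod_cast Fintype.card_ne_zero
  field_simp
  rw [mul_comm]
  exact h1

/-- An event about the `j`-th coordinate is independent of an event about the others. -/
lemma pr_and_of_update_iff [Nonempty α] (j : ι) (P : α → Prop) (Q : (ι → α) → Prop)
    (hQ : ∀ ω c, Q (Function.update ω j c) ↔ Q ω) :
    pr (fun ω : ι → α => P (ω j) ∧ Q ω) = pr P * pr Q := by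
  classical
  have := expect_mul_of_update_eq j (fun c => if P c then (1 : ℝ) else 0)
    (fun ω => if Q ω then (1 : ℝ) else 0) (fun ω c => by simp [hQ])
  simp only [pr]
  rw [← this]
  refine Finset.expect_congr rfl fun ω _ => ?_
  by_cases h1 : P (ω j) <;> by_cases h2 : Q ω <;> simp [h1, h2]

/-- The coordinates are independent and identically distributed. -/
lemma pr_forall_mem [Nonempty α] (J : Finset ι) (P : α → Prop) :
    pr (fun ω : ι → α => ∀ i ∈ J, P (ω i)) = pr P ^ #J := by
  classical
  induction J using Finset.induction_on with
  | empty => simp [pr]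
  | insert j J hj ih =>
    rw [Finset.card_insert_of_notMem hj, pow_succ', ← ih, ← pr_and_of_update_iff j P]
    · simp
    · intro ω c
      refine forall₂_congr fun i hi => ?_
      rw [Function.update_of_ne]
      rintro rfl; exact hj hi

end Averages

/-! ### Connectivity and forests in hypergraphs -/

section Hypergraphs

variable {V ι : Type*}

/-- `u` and `v` are joined by a path of hyperedges `E j`, `j ∈ T`. -/
def Conn (E : ι → Finset V) (T : Finset ι) : V → V → Prop :=
  Relation.ReflTransGen fun u v => ∃ j ∈ T, u ∈ E j ∧ v ∈ E j

variable {E : ι → Finset V} {S T : Finset ι} {u v : V}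

lemma Conn.mono (hST : S ⊆ T) (h : Conn E S u v) : Conn E T u v :=
  Relation.ReflTransGen.mono (fun _ _ ⟨j, hj, h⟩ => ⟨j, hST hj, h⟩) _ _ h

lemma Conn.congr {E' : ι → Finset V} (hE : ∀ j ∈ T, E j = E' j) :
    Conn E T u v ↔ Conn E' T u v := by
  have : (fun u v => ∃ j ∈ T, u ∈ E j ∧ v ∈ E j) = fun u v => ∃ j ∈ T, u ∈ E' j ∧ v ∈ E' j := by
    funext x y
    refine propext (exists_congr fun j => and_congr_right fun hj => ?_)
    rw [hE j hj]
  unfold Conn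
  rw [this]

lemma Conn.eq_of_notMem [DecidableEq V] (h : Conn E T u v) (hu : u ∉ T.biUnion E) : u = v := by
  rcases Relation.ReflTransGen.cases_head h with h | ⟨w, ⟨j, hj, hu', -⟩, -⟩
  · exact h
  · exact absurd (mem_biUnion.2 ⟨j, hj, hu'⟩) hu

/-- A path either avoids the hyperedge `E j`, or can be cut behind its last use of `E j`. -/
lemma Conn.erase_or [DecidableEq ι] (j : ι) (h : Conn E T u v) :
    Conn E (T.erase j) u v ∨ ∃ w ∈ E j, Conn E (T.erase j) w v := by
  induction h using Relation.ReflTransGen.head_induction_on with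
  | refl => exact Or.inl Relation.ReflTransGen.refl
  | head hxy _ ih =>
    obtain ⟨i, hi, hx, hy⟩ := hxy
    rcases ih with ih | ih
    · by_cases hij : i = j
      · subst hij; exact Or.inr ⟨_, hy, ih⟩
      · exact Or.inl (Relation.ReflTransGen.head ⟨i, mem_erase.2 ⟨hij, hi⟩, hx, hy⟩ ih)
    · exact Or.inr ih

/-- The first hyperedge of a suitable path is not used again. -/
lemma Conn.eq_or_exists_erase [DecidableEq ι] (h : Conn E T u v) :
    u = v ∨ ∃ j ∈ T, u ∈ E j ∧ ∃ w ∈ E j, w ≠ u ∧ Conn E (T.erase j) w v := by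
  induction hn : #T generalizing T with
  | zero =>
    rcases Relation.ReflTransGen.cases_head h with h | ⟨w, ⟨j, hj, -⟩, -⟩
    · exact Or.inl h
    · simp [card_eq_zero.1 hn] at hj
  | succ n ih =>
    rcases Relation.ReflTransGen.cases_head h with h | ⟨x, ⟨j, hj, hu, hx⟩, hxv⟩
    · exact Or.inl h
    have hw : ∃ w ∈ E j, Conn E (T.erase j) w v := by
      rcases Conn.erase_or j hxv with h' | h'
      · exact ⟨x, hx, h'⟩
      · exact h'
    obtain ⟨w, hw, hwv⟩ := hw
    by_cases hwu : w = u
    · subst hwu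
      rcases ih hwv (by rw [card_erase_of_mem hj, hn]; rfl) with h' | ⟨i, hi, hui, y, hy, hyu, h'⟩
      · exact Or.inl h'
      · exact Or.inr ⟨i, mem_of_mem_erase hi, hui, y, hy, hyu,
          h'.mono (erase_subset_erase _ (erase_subset _ _))⟩
    · exact Or.inr ⟨j, hj, hu, w, hw, hwu, hwv⟩

variable [LinearOrder ι] [LocallyFiniteOrderBot ι]

/-- The hyperedge `E j` closes a cycle with the preceding ones: two of its vertices are already
connected. -/
def ClosesCycle (E : ι → Finset V) (j : ι) : Prop :=
  ∃ u ∈ E j, ∃ v ∈ E j, u ≠ v ∧ Conn E (Iio j) u v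

variable [Fintype V] [DecidableEq V]

/-- The function `rep` is a union-find structure for the hyperforest `I`: each hyperedge merges
`k` classes into one. -/
lemma exists_rep_of_forest {k : ℕ} (hk : 1 ≤ k) (I : Finset ι) (hcard : ∀ j ∈ I, #(E j) = k)
    (hI : ∀ j ∈ I, ¬ ClosesCycle E j) :
    ∃ rep : V → V, (∀ u v, rep u = rep v → Conn E I u v) ∧ (∀ u ∉ I.biUnion E, rep u = u) ∧
      #(univ.image rep) + (k - 1) * #I ≤ Fintype.card V := by
  induction I using Finset.induction_on_max with
  | empty =>
    refine ⟨id, ?_, fun _ _ => rfl, ?_⟩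
    · rintro u v h
      rw [show u = v from h]; exact Relation.ReflTransGen.refl
    · simp
  | insert j I hj ih =>
    obtain ⟨rep, h1, h2, h3⟩ := ih (fun i hi => hcard i (mem_insert_of_mem hi))
      (fun i hi => hI i (mem_insert_of_mem hi))
    have hEj := hcard j (mem_insert_self _ _)
    have hgood := hI j (mem_insert_self _ _)
    have hjI : j ∉ I := fun h => lt_irrefl _ (hj j h)
    have hinj : Set.InjOn rep (E j) := by
      intro a ha b hb hab
      by_contra hne
      exact hgood ⟨a, ha, b, hb, hne, (h1 a b hab).mono fun i hi => mem_Iio.2 (hj i hi)⟩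
    obtain ⟨l, hl⟩ : (E j).Nonempty := card_pos.1 (by omega)
    have hsub : I ⊆ insert j I := subset_insert _ _
    have hjoin : ∀ a ∈ E j, ∀ b ∈ E j, Conn E (insert j I) a b := fun a ha b hb =>
      Relation.ReflTransGen.single ⟨j, mem_insert_self _ _, ha, hb⟩
    refine ⟨fun u => if rep u ∈ (E j).image rep then rep l else rep u, ?_, ?_, ?_⟩
    · intro u v huv
      have hl' : rep l ∈ (E j).image rep := mem_image_of_mem _ hl
      by_cases hu : rep u ∈ (E j).image rep <;> by_cases hv : rep v ∈ (E j).image rep <;>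
        simp only [hu, hv, if_true, if_false] at huv
      · obtain ⟨a, ha, hau⟩ := mem_image.1 hu
        obtain ⟨b, hb, hbv⟩ := mem_image.1 hv
        exact (((h1 u a hau.symm).mono hsub).trans (hjoin a ha b hb)).trans
          ((h1 b v hbv).mono hsub)
      · exact absurd (huv ▸ hl') hv
      · exact absurd (huv ▸ hl') hu
      · exact (h1 u v huv).mono hsub
    · intro u hu
      rw [biUnion_insert, mem_union, not_or] at hu
      have hru := h2 u hu.2
      have : rep u ∉ (E j).image rep := by
        intro h
        obtain ⟨a, ha, hau⟩ := mem_image.1 h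
        have := (h1 u a hau.symm).eq_of_notMem hu.2
        exact hu.1 (this ▸ ha)
      exact (if_neg this).trans hru
    · have hle : #(univ.image fun u => if rep u ∈ (E j).image rep then rep l else rep u) ≤
          #((univ.image rep \ (E j).image rep) ∪ {rep l}) := by
        refine card_le_card fun x hx => ?_
        obtain ⟨u, -, rfl⟩ := mem_image.1 hx
        split_ifs with h
        · simp
        · exact mem_union_left _ (mem_sdiff.2 ⟨mem_image_of_mem _ (mem_univ _), h⟩)
      have h4 := card_union_le (univ.image rep \ (E j).image rep) {rep l}
      have h5 : #(univ.image rep \ (E j).image rep) + #((E j).image rep) = #(univ.image rep) :=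
        card_sdiff_add_card_eq_card (image_subset_image (subset_univ _))
      rw [card_image_of_injOn hinj, hEj] at h5
      rw [card_singleton] at h4
      rw [card_insert_of_notMem hjI, mul_add]
      omega

/-- The number of vertices of a hypergraph is at least `k - 1` times the number of those of its
hyperedges that do not close a cycle. -/
lemma mul_card_le_card_biUnion {k : ℕ} (hk : 1 ≤ k) (I : Finset ι) (hcard : ∀ j ∈ I, #(E j) = k)
    (hI : ∀ j ∈ I, ¬ ClosesCycle E j) : (k - 1) * #I ≤ #(I.biUnion E) := by
  obtain ⟨rep, -, h2, h3⟩ := exists_rep_of_forest hk I hcard hI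
  have h4 : #(univ \ I.biUnion E) ≤ #(univ.image rep) := by
    refine card_le_card fun u hu => ?_
    exact mem_image.2 ⟨u, mem_univ _, h2 u (mem_sdiff.1 hu).2⟩
  have h5 := card_sdiff_add_card_eq_card (subset_univ (I.biUnion E))
  rw [card_univ] at h5
  omega

end Hypergraphs

/-! ### Subcritical random hypergraphs of literals -/

section RandomConstraint

variable {k : ℕ} {𝒞 : Finset (Template k)} {n : ℕ}

/-- The set of literals of a constraint. -/
def Constr.lits (c : Constr 𝒞 n) : Finset (Literal n) := univ.image fun i => Constr.lit c i

lemma Constr.lit_injective (c : Constr 𝒞 n) : Function.Injective (Constr.lit c) := fun _ _ h =>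
  c.1.injective (congrArg Prod.fst h)

lemma Constr.card_lits (c : Constr 𝒞 n) : #(Constr.lits c) = k := by
  rw [Constr.lits, card_image_of_injective _ (Constr.lit_injective c), card_univ, Fintype.card_fin]

lemma Constr.eq_of_mem_lits {c : Constr 𝒞 n} {u w : Literal n} (hu : u ∈ Constr.lits c)
    (hw : w ∈ Constr.lits c) (h : u.1 = w.1) : u = w := by
  obtain ⟨i, -, rfl⟩ := mem_image.1 hu
  obtain ⟨j, -, rfl⟩ := mem_image.1 hw
  rw [c.1.injective h]

lemma nonempty_constr (hne : 𝒞.Nonempty) (hn : k ≤ n) : Nonempty (Constr 𝒞 n) := by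
  obtain ⟨R, hR⟩ := hne
  exact ⟨(Fin.castLEEmb hn, fun _ => true, ⟨R, hR⟩)⟩

/-- The permutation of the literals that renames the variables by `σ` and then negates some. -/
def Literal.act (σ : Equiv.Perm (Fin n)) (τ : Fin n → Bool) (l : Literal n) : Literal n :=
  (σ l.1, xor l.2 (τ l.1))

lemma Literal.act_injective (σ : Equiv.Perm (Fin n)) (τ : Fin n → Bool) :
    Function.Injective (Literal.act σ τ) := by
  rintro ⟨x, a⟩ ⟨y, b⟩ h
  simp only [Literal.act, Prod.mk.injEq, EmbeddingLike.apply_eq_iff_eq] at h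
  obtain ⟨rfl, h⟩ := h
  simpa using h

/-- The action of `Literal.act` on constraints. -/
def Constr.act (σ : Equiv.Perm (Fin n)) (τ : Fin n → Bool) (c : Constr 𝒞 n) : Constr 𝒞 n :=
  (c.1.trans σ.toEmbedding, fun i => xor (c.2.1 i) (τ (c.1 i)), c.2.2)

lemma Constr.lits_act (σ : Equiv.Perm (Fin n)) (τ : Fin n → Bool) (c : Constr 𝒞 n) :
    Constr.lits (Constr.act σ τ c) = (Constr.lits c).image (Literal.act σ τ) := by
  rw [Constr.lits, Constr.lits, image_image]; rfl

lemma Constr.act_bijective (σ : Equiv.Perm (Fin n)) (τ : Fin n → Bool) :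
    Function.Bijective (Constr.act (𝒞 := 𝒞) σ τ) := by
  refine Finite.injective_iff_bijective.1 ?_
  rintro ⟨f, e, R⟩ ⟨g, e', R'⟩ h
  simp only [Constr.act, Prod.mk.injEq] at h
  obtain ⟨h1, h2, rfl⟩ := h
  have h1 : f = g := by
    refine DFunLike.ext _ _ fun i => ?_
    have := congrArg (fun F : Fin k ↪ Fin n => F i) h1
    simpa using this
  subst h1
  have h2 : e = e' := by
    funext i
    have := congrFun h2 i
    simpa using this
  subst h2; rfl

lemma exists_act_eq {u w u' w' : Literal n} (h : u.1 ≠ w.1) (h' : u'.1 ≠ w'.1) :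
    ∃ σ τ, Literal.act σ τ u = u' ∧ Literal.act σ τ w = w' := by
  refine ⟨Equiv.swap u.1 u'.1 |>.trans (Equiv.swap (Equiv.swap u.1 u'.1 w.1) w'.1),
    fun x => if x = u.1 then xor u.2 u'.2 else xor w.2 w'.2, ?_, ?_⟩
  · have h1 : u'.1 ≠ Equiv.swap u.1 u'.1 w.1 := by
      intro h2
      rw [← Equiv.swap_apply_left u.1 u'.1] at h2
      exact h ((Equiv.swap u.1 ((Equiv.swap u.1 u'.1) u.1)).injective
        (by simpa using h2))
    refine Prod.ext ?_ ?_
    · simp [Literal.act, Equiv.swap_apply_of_ne_of_ne h1 h']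
    · simp [Literal.act]
  · refine Prod.ext ?_ ?_
    · simp [Literal.act]
    · simp [Literal.act, h.symm]

/-- Two given literals belong to a random constraint with probability at most
`k (k - 1) / (4 n (n - 1))`: if their variables differ, all such pairs are equally likely. -/
lemma pr_two_mem_lits_le (hne : 𝒞.Nonempty) (hkn : k ≤ n) (hn : 2 ≤ n) {u w : Literal n}
    (huw : u ≠ w) :
    pr (fun c : Constr 𝒞 n => u ∈ Constr.lits c ∧ w ∈ Constr.lits c) ≤
      (k * (k - 1) : ℝ) / (4 * n * (n - 1)) := by
  classical
  have := nonempty_constr (n := n) hne hkn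
  have hn' : (0 : ℝ) < n - 1 := by
    have : (2 : ℝ) ≤ n := by exact_mod_cast hn
    linarith
  have hk0 : (0 : ℝ) ≤ k * (k - 1) := by
    rcases Nat.eq_zero_or_pos k with rfl | h
    · simp
    · have : (1 : ℝ) ≤ k := by exact_mod_cast h
      nlinarith
  by_cases hvar : u.1 = w.1
  · have : pr (fun c : Constr 𝒞 n => u ∈ Constr.lits c ∧ w ∈ Constr.lits c) = 0 := by
      have h0 : ∀ c : Constr 𝒞 n, ¬ (u ∈ Constr.lits c ∧ w ∈ Constr.lits c) := fun c h =>
        huw (Constr.eq_of_mem_lits h.1 h.2 hvar)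
      simp [pr, h0]
    rw [this]
    positivity
  set p := pr (fun c : Constr 𝒞 n => u ∈ Constr.lits c ∧ w ∈ Constr.lits c) with hp
  let P : Finset ((Fin n × Fin n) × Bool × Bool) := (univ : Finset (Fin n)).offDiag ×ˢ univ
  let L : (Fin n × Fin n) × Bool × Bool → Literal n × Literal n :=
    fun q => ((q.1.1, q.2.1), (q.1.2, q.2.2))
  have hL : Function.Injective L := by
    rintro ⟨⟨a, b⟩, c, d⟩ ⟨⟨a', b'⟩, c', d'⟩ h
    simp only [L, Prod.mk.injEq] at h ⊢
    tauto
  have hq : ∀ q ∈ P,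
      pr (fun c : Constr 𝒞 n => (L q).1 ∈ Constr.lits c ∧ (L q).2 ∈ Constr.lits c) = p := by
    rintro q hq
    have hq1 : (L q).1.1 ≠ (L q).2.1 := by simpa [P, L] using hq
    obtain ⟨σ, τ, h1, h2⟩ := exists_act_eq hvar hq1
    rw [hp, pr, pr]
    symm
    refine Fintype.expect_equiv (Equiv.ofBijective _ (Constr.act_bijective σ τ)) _ _ fun c => ?_
    have h3 : ∀ l, Literal.act σ τ l ∈ Constr.lits (Constr.act σ τ c) ↔ l ∈ Constr.lits c := by
      intro l
      rw [Constr.lits_act]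
      exact (Literal.act_injective σ τ).mem_finset_image
    simp only [Equiv.ofBijective_apply, ← h1, ← h2, h3]
    congr
  have hsum : ∑ q ∈ P,
      pr (fun c : Constr 𝒞 n => (L q).1 ∈ Constr.lits c ∧ (L q).2 ∈ Constr.lits c) ≤
      (k * (k - 1) : ℝ) := by
    rw [sum_pr_eq_expect_card]
    refine Finset.expect_le univ_nonempty fun c _ => ?_
    have hle : #(P.filter fun q => (L q).1 ∈ Constr.lits c ∧ (L q).2 ∈ Constr.lits c) ≤
        #((Constr.lits c).offDiag) := by
      refine card_le_card_of_injOn L ?_ hL.injOn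
      intro q hq
      have hq := mem_filter.1 (mem_coe.1 hq)
      have hq1 : (L q).1.1 ≠ (L q).2.1 := by simpa [P, L] using hq.1
      exact mem_coe.2 (mem_offDiag.2 ⟨hq.2.1, hq.2.2, fun h => hq1 (congrArg Prod.fst h)⟩)
    rw [offDiag_card, Constr.card_lits] at hle
    have hle' : ((k * k - k : ℕ) : ℝ) = k * (k - 1) := by
      rw [Nat.cast_sub (Nat.le_mul_self k)]; push_cast; ring
    rw [← hle']
    refine Nat.cast_le.2 (le_trans (le_of_eq ?_) hle)
    congr
  rw [Finset.sum_congr rfl hq, Finset.sum_const, nsmul_eq_mul] at hsum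
  have hP : (#P : ℝ) = 4 * n * (n - 1) := by
    have : #P = (n * n - n) * 4 := by
      simp [P, offDiag_card]
    rw [this]
    push_cast [Nat.cast_sub (Nat.le_mul_self n)]
    ring
  rw [hP] at hsum
  rw [le_div_iff₀ (by positivity)]
  linarith

/-- A random constraint joins a given literal to `k (k - 1) / (2 n)` others on average. -/
lemma sum_pr_two_mem_lits_le (hne : 𝒞.Nonempty) (hkn : k ≤ n) (hn : 2 ≤ n) (u : Literal n) :
    ∑ w ∈ univ.erase u, pr (fun c : Constr 𝒞 n => u ∈ Constr.lits c ∧ w ∈ Constr.lits c) ≤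
      (k * (k - 1) : ℝ) / (2 * n) := by
  classical
  have hn' : (0 : ℝ) < n - 1 := by
    have : (2 : ℝ) ≤ n := by exact_mod_cast hn
    linarith
  have hn0 : (0 : ℝ) < n := by linarith
  let S : Finset (Literal n) := univ.erase u.1 ×ˢ univ
  have hS : S ⊆ univ.erase u := by
    intro w hw
    have : w.1 ≠ u.1 := by simpa [S] using hw
    simpa using fun h => this (congrArg Prod.fst h)
  rw [← Finset.sum_subset hS]
  · calc ∑ w ∈ S, pr (fun c : Constr 𝒞 n => u ∈ Constr.lits c ∧ w ∈ Constr.lits c)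
        ≤ ∑ w ∈ S, (k * (k - 1) : ℝ) / (4 * n * (n - 1)) :=
          Finset.sum_le_sum fun w hw =>
            pr_two_mem_lits_le hne hkn hn (ne_of_mem_erase (hS hw)).symm
      _ = (k * (k - 1) : ℝ) / (2 * n) := by
        have hc : #S = (n - 1) * 2 := by simp [S]
        rw [Finset.sum_const, nsmul_eq_mul, hc]
        push_cast [Nat.cast_sub (show 1 ≤ n by omega)]
        field_simp
        ring
  · intro w hw hwS
    have h1 : w.1 = u.1 := by simpa [S] using hwS
    have h0 : ∀ c : Constr 𝒞 n, ¬ (u ∈ Constr.lits c ∧ w ∈ Constr.lits c) := fun c h =>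
      (ne_of_mem_erase hw) (Constr.eq_of_mem_lits h.2 h.1 h1)
    simp [pr, h0]

variable {ι : Type*} [DecidableEq ι]

lemma conn_update_iff {T : Finset ι} {j : ι} (hj : j ∉ T) (u v : Literal n)
    (ω : ι → Constr 𝒞 n) (c : Constr 𝒞 n) :
    Conn (fun i => Constr.lits (Function.update ω j c i)) T u v ↔
      Conn (fun i => Constr.lits (ω i)) T u v := by
  refine Conn.congr fun i hi => ?_
  rw [Function.update_of_ne]
  rintro rfl; exact hj hi

/-- In the subcritical regime, the expected number of literals connected to a given one is
bounded: by `Conn.eq_or_exists_erase` it is dominated by the total size of a branching process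
with mean offspring at most `1 - δ`. -/
lemma sum_pr_conn_le [Fintype ι] (hne : 𝒞.Nonempty) (hkn : k ≤ n) (hk : 1 ≤ k) (hn : 2 ≤ n) {δ : ℝ}
    (hδ : 0 < δ) (T : Finset ι) (hT : (#T : ℝ) * ((k * (k - 1) : ℝ) / (2 * n)) ≤ 1 - δ)
    (u : Literal n) :
    ∑ v, pr (fun ω : ι → Constr 𝒞 n => Conn (fun i => Constr.lits (ω i)) T u v) ≤ 1 / δ := by
  classical
  have := nonempty_constr (n := n) hne hkn
  have hk1 : (0 : ℝ) ≤ (k : ℝ) - 1 := by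
    have : (1 : ℝ) ≤ k := by exact_mod_cast hk
    linarith
  set q : ℝ := (k * (k - 1) : ℝ) / (2 * n) with hq
  have hq0 : 0 ≤ q := by positivity
  induction hN : #T generalizing T u with
  | zero =>
    rw [card_eq_zero.1 hN] at hT ⊢
    have h0 : ∀ v, pr (fun ω : ι → Constr 𝒞 n => Conn (fun i => Constr.lits (ω i)) ∅ u v) ≤
        if u = v then 1 else 0 := by
      intro v
      split_ifs with h
      · exact pr_le_one _
      · have h0 : ∀ ω : ι → Constr 𝒞 n, ¬ Conn (fun i => Constr.lits (ω i)) ∅ u v := fun ω h' =>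
          h (h'.eq_of_notMem (by simp))
        simp [pr, h0]
    refine (Finset.sum_le_sum fun v _ => h0 v).trans ?_
    simp only [sum_ite_eq, mem_univ, if_true]
    rw [le_div_iff₀ hδ]
    simp at hT
    linarith
  | succ N ih =>
    let p : Literal n → ℝ := fun w =>
      pr (fun c : Constr 𝒞 n => u ∈ Constr.lits c ∧ w ∈ Constr.lits c)
    let g : ι → Literal n → Literal n → ℝ := fun j w v =>
      pr (fun ω : ι → Constr 𝒞 n => Conn (fun i => Constr.lits (ω i)) (T.erase j) w v)
    have hstep : ∀ v, pr (fun ω : ι → Constr 𝒞 n => Conn (fun i => Constr.lits (ω i)) T u v) ≤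
        (if u = v then 1 else 0) + ∑ j ∈ T, ∑ w ∈ univ.erase u, p w * g j w v := by
      intro v
      refine (pr_mono (Q := fun ω : ι → Constr 𝒞 n => u = v ∨ ∃ j ∈ T, ∃ w ∈ univ.erase u,
        (u ∈ Constr.lits (ω j) ∧ w ∈ Constr.lits (ω j)) ∧
          Conn (fun i => Constr.lits (ω i)) (T.erase j) w v) ?_).trans ?_
      · intro ω h
        rcases h.eq_or_exists_erase with h | ⟨j, hj, hu, w, hw, hwu, h⟩
        · exact Or.inl h
        · exact Or.inr ⟨j, hj, w, by simp [hwu], ⟨hu, hw⟩, h⟩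
      refine (pr_or_le _ _).trans (add_le_add ?_ ?_)
      · split_ifs with h
        · exact pr_le_one _
        · simp [pr, h]
      refine (pr_exists_le _ _).trans (Finset.sum_le_sum fun j _ => ?_)
      refine (pr_exists_le _ _).trans (Finset.sum_le_sum fun w _ => le_of_eq ?_)
      exact pr_and_of_update_iff j (fun c => u ∈ Constr.lits c ∧ w ∈ Constr.lits c) _
        fun ω c => conn_update_iff (notMem_erase j T) w v ω c
    have hbound : ∀ j ∈ T, ∑ w ∈ univ.erase u, p w * ∑ v, g j w v ≤ q * (1 / δ) := by
      intro j hj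
      have hc : #(T.erase j) = N := by rw [card_erase_of_mem hj, hN]; rfl
      calc ∑ w ∈ univ.erase u, p w * ∑ v, g j w v
          ≤ ∑ w ∈ univ.erase u, p w * (1 / δ) := by
            refine Finset.sum_le_sum fun w _ => mul_le_mul_of_nonneg_left ?_ (pr_nonneg _)
            refine ih (T.erase j) w (le_trans ?_ hT) hc
            gcongr
            exact erase_subset _ _
        _ ≤ q * (1 / δ) := by
            rw [← Finset.sum_mul]
            gcongr
            exact sum_pr_two_mem_lits_le hne hkn hn u
    calc ∑ v, pr (fun ω : ι → Constr 𝒞 n => Conn (fun i => Constr.lits (ω i)) T u v)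
        ≤ ∑ v, ((if u = v then 1 else 0) + ∑ j ∈ T, ∑ w ∈ univ.erase u, p w * g j w v) :=
          Finset.sum_le_sum fun v _ => hstep v
      _ = 1 + ∑ j ∈ T, ∑ w ∈ univ.erase u, p w * ∑ v, g j w v := by
          rw [Finset.sum_add_distrib]
          congr 1
          · simp
          · rw [Finset.sum_comm]
            refine Finset.sum_congr rfl fun j _ => ?_
            rw [Finset.sum_comm]
            simp only [Finset.mul_sum]
      _ ≤ 1 + ∑ j ∈ T, q * (1 / δ) := by
          gcongr with j hj
          exact hbound j hj
      _ = 1 + (#T * q) * (1 / δ) := by rw [Finset.sum_const, nsmul_eq_mul]; ring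
      _ ≤ 1 + (1 - δ) * (1 / δ) := by gcongr
      _ = 1 / δ := by field_simp; ring

/-- In the subcritical regime, the hypergraph of literals is close to a forest. -/
lemma pr_closesCycle_le (hne : 𝒞.Nonempty) (hkn : k ≤ n) (hk : 1 ≤ k) (hn : 2 ≤ n) {δ : ℝ}
    (hδ : 0 < δ) {m : ℕ} (j : Fin m)
    (hj : ((j : ℕ) : ℝ) * ((k * (k - 1) : ℝ) / (2 * n)) ≤ 1 - δ) :
    pr (fun ω : Fin m → Constr 𝒞 n => ClosesCycle (fun i => Constr.lits (ω i)) j) ≤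
      (k * (k - 1) : ℝ) / (2 * (n - 1) * δ) := by
  classical
  have := nonempty_constr (n := n) hne hkn
  have hn' : (0 : ℝ) < n - 1 := by
    have : (2 : ℝ) ≤ n := by exact_mod_cast hn
    linarith
  have hn0 : (0 : ℝ) < n := by linarith
  have hk1 : (0 : ℝ) ≤ (k : ℝ) - 1 := by
    have : (1 : ℝ) ≤ k := by exact_mod_cast hk
    linarith
  set p : ℝ := (k * (k - 1) : ℝ) / (4 * n * (n - 1)) with hp
  have hp0 : 0 ≤ p := by positivity
  have hj' : (#(Iio j) : ℝ) * ((k * (k - 1) : ℝ) / (2 * n)) ≤ 1 - δ := by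
    rwa [Fin.card_Iio]
  let g : Literal n → Literal n → ℝ := fun u v =>
    pr (fun ω : Fin m → Constr 𝒞 n => Conn (fun i => Constr.lits (ω i)) (Iio j) u v)
  calc pr (fun ω : Fin m → Constr 𝒞 n => ClosesCycle (fun i => Constr.lits (ω i)) j)
      ≤ pr (fun ω : Fin m → Constr 𝒞 n => ∃ u ∈ univ, ∃ v ∈ univ.erase u,
          (u ∈ Constr.lits (ω j) ∧ v ∈ Constr.lits (ω j)) ∧
            Conn (fun i => Constr.lits (ω i)) (Iio j) u v) := by
        refine pr_mono ?_
        rintro ω ⟨u, hu, v, hv, huv, h⟩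
        exact ⟨u, mem_univ _, v, by simp [huv.symm], ⟨hu, hv⟩, h⟩
    _ ≤ ∑ u, ∑ v ∈ univ.erase u, p * g u v := by
        refine (pr_exists_le _ _).trans (Finset.sum_le_sum fun u _ => ?_)
        refine (pr_exists_le _ _).trans (Finset.sum_le_sum fun v hv => ?_)
        rw [pr_and_of_update_iff j (fun c => u ∈ Constr.lits c ∧ v ∈ Constr.lits c) _
          fun ω c => conn_update_iff (by simp) u v ω c]
        exact mul_le_mul_of_nonneg_right
          (pr_two_mem_lits_le hne hkn hn (ne_of_mem_erase hv).symm) (pr_nonneg _)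
    _ ≤ ∑ u : Literal n, p * (1 / δ) := by
        refine Finset.sum_le_sum fun u _ => ?_
        rw [← Finset.mul_sum]
        gcongr
        refine le_trans ?_ (sum_pr_conn_le hne hkn hk hn hδ (Iio j) hj' u)
        exact Finset.sum_le_sum_of_subset_of_nonneg (erase_subset _ _)
          fun _ _ _ => pr_nonneg _
    _ = (k * (k - 1) : ℝ) / (2 * (n - 1) * δ) := by
        rw [Finset.sum_const, nsmul_eq_mul, card_univ, Fintype.card_prod, Fintype.card_fin,
          Fintype.card_bool, hp]
        push_cast
        field_simp
        ring

end RandomConstraint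

/-! ### Sparseness of random formulas -/

section Sparse

variable {k : ℕ} {𝒞 : Finset (Template k)} {n : ℕ}

lemma descFactorial_mul_pow_le {s n : ℕ} (h : s ≤ n) (k : ℕ) :
    s.descFactorial k * n ^ k ≤ n.descFactorial k * s ^ k := by
  induction k with
  | zero => simp
  | succ k ih =>
    have h1 : (s - k) * n ≤ (n - k) * s := by
      rw [Nat.sub_mul, Nat.sub_mul, mul_comm s n]
      exact Nat.sub_le_sub_left (Nat.mul_le_mul_left k h) _
    calc s.descFactorial (k + 1) * n ^ (k + 1)
        = ((s - k) * n) * (s.descFactorial k * n ^ k) := by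
          rw [Nat.descFactorial_succ]; ring
      _ ≤ ((n - k) * s) * (n.descFactorial k * s ^ k) := Nat.mul_le_mul h1 ih
      _ = _ := by rw [Nat.descFactorial_succ]; ring

lemma card_constr (𝒞 : Finset (Template k)) (n : ℕ) :
    Fintype.card (Constr 𝒞 n) = n.descFactorial k * (2 ^ k * #𝒞) := by
  simp [Fintype.card_embedding_eq]

lemma pr_vars_subset_le (hne : 𝒞.Nonempty) (hkn : k ≤ n) (hn : 0 < n) (V : Finset (Fin n)) :
    pr (fun c : Constr 𝒞 n => Constr.vars c ⊆ V) ≤ ((#V : ℝ) / n) ^ k := by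
  classical
  have hd : 0 < n.descFactorial k := Nat.descFactorial_pos.2 hkn
  have hC : 0 < 2 ^ k * #𝒞 := by have := card_pos.2 hne; positivity
  have hle : #(@Finset.filter _ (fun c : Constr 𝒞 n => Constr.vars c ⊆ V)
      (fun _ => Classical.propDecidable _) univ) ≤ (#V).descFactorial k * (2 ^ k * #𝒞) := by
    have h1 : (#V).descFactorial k * (2 ^ k * #𝒞) =
        Fintype.card ((Fin k ↪ V) × (Fin k → Bool) × {R : Template k // R ∈ 𝒞}) := by
      simp [Fintype.card_embedding_eq]
    rw [h1, ← card_univ, ← Fintype.card_coe, ← card_univ]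
    refine card_le_card_of_injOn (fun c => ⟨⟨fun i => ⟨c.1.1 i, ?_⟩, ?_⟩, c.1.2⟩)
      (fun _ _ => mem_coe.2 (mem_univ _)) ?_
    · have h : Constr.vars c.1 ⊆ V := ((@mem_filter _ _ (_) _ _).1 c.2).2
      exact h (mem_image_of_mem _ (mem_univ i))
    · intro i j h
      exact c.1.1.injective (congrArg Subtype.val h)
    · rintro ⟨⟨f, q⟩, h⟩ - ⟨⟨f', q'⟩, h'⟩ - heq
      simp only [Prod.mk.injEq] at heq
      obtain ⟨h1, rfl⟩ := heq
      have : f = f' := DFunLike.ext _ _ fun i => by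
        exact congrArg (fun F : Fin k ↪ V => (F i).1) h1
      subst this; rfl
  have hV : #V ≤ n := by simpa using card_le_univ V
  rw [pr_eq_card_div, card_constr, div_pow]
  rw [div_le_div_iff₀ (by positivity) (by positivity)]
  have hle' := descFactorial_mul_pow_le hV k
  refine (mul_le_mul_of_nonneg_right (Nat.cast_le.2 hle) (by positivity)).trans ?_
  norm_cast
  calc (#V).descFactorial k * (2 ^ k * #𝒞) * n ^ k
      = ((#V).descFactorial k * n ^ k) * (2 ^ k * #𝒞) := by ring
    _ ≤ (n.descFactorial k * #V ^ k) * (2 ^ k * #𝒞) := by gcongr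
    _ = _ := by ring

/-- Every subformula on at most `η n` variables has at most `(1 + θ) / (k - 1)` times as many
constraints as variables. -/
def Formula.Sparse (θ η : ℝ) (Φ : Formula 𝒞 n) : Prop :=
  ∀ Ξ ⊆ Φ, (#(Formula.vars Ξ) : ℝ) ≤ η * n →
    ((k : ℝ) - 1) * #Ξ ≤ (1 + θ) * #(Formula.vars Ξ)

/-- The least number of constraints that is too large for a sparse formula on `s` variables. -/
noncomputable def excessCount (k : ℕ) (θ : ℝ) (s : ℕ) : ℕ := ⌊(1 + θ) * s / ((k : ℝ) - 1)⌋₊ + 1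

lemma exists_injOn_image_eq {ι α : Type*} [DecidableEq α] (ω : ι → α) {T : Finset ι}
    {Ξ : Finset α} (hΞ : Ξ ⊆ T.image ω) : ∃ T' ⊆ T, Set.InjOn ω T' ∧ T'.image ω = Ξ := by
  classical
  obtain ⟨T', hT', rfl⟩ := subset_image_iff.1 hΞ
  obtain ⟨T'', h1, h2⟩ := (T' : Set ι).exists_subset_bijOn ω
  have hfin : T''.Finite := T'.finite_toSet.subset h1
  refine ⟨hfin.toFinset, fun x hx => hT' (h1 (hfin.mem_toFinset.1 hx)), ?_, ?_⟩
  · simpa using h2.injOn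
  · rw [← coe_inj]
    simpa using h2.image_eq

lemma exists_of_not_sparse {ι : Type*} [DecidableEq ι] (hk : 2 ≤ k) {θ η : ℝ} (hθ : 0 ≤ θ)
    (ω : ι → Constr 𝒞 n) (T : Finset ι) (h : ¬ Formula.Sparse θ η (T.image ω)) :
    ∃ s ∈ Icc 1 ⌊η * n⌋₊, ∃ V ∈ powersetCard s (univ : Finset (Fin n)),
      ∃ J ∈ powersetCard (excessCount k θ s) T, ∀ i ∈ J, Constr.vars (ω i) ⊆ V := by
  simp only [Formula.Sparse, not_forall, not_le] at h
  obtain ⟨Ξ, hΞ, hs, hlt⟩ := h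
  have hk1 : (0 : ℝ) < (k : ℝ) - 1 := by
    have : (2 : ℝ) ≤ k := by exact_mod_cast hk
    linarith
  have hΞne : Ξ.Nonempty := by
    rw [nonempty_iff_ne_empty]
    rintro rfl
    simp only [card_empty, Nat.cast_zero, mul_zero] at hlt
    have : (0 : ℝ) ≤ (1 + θ) * #(Formula.vars (∅ : Formula 𝒞 n)) := by positivity
    linarith
  have hpos : 1 ≤ #(Formula.vars Ξ) := by
    obtain ⟨c, hc⟩ := hΞne
    exact card_pos.2 ⟨c.1 ⟨0, by omega⟩,
      mem_biUnion.2 ⟨c, hc, mem_image_of_mem _ (mem_univ _)⟩⟩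
  have hr : excessCount k θ #(Formula.vars Ξ) ≤ #Ξ := by
    have : ⌊(1 + θ) * #(Formula.vars Ξ) / ((k : ℝ) - 1)⌋₊ < #Ξ := by
      rw [Nat.floor_lt (by positivity), div_lt_iff₀ hk1]
      linarith
    exact this
  obtain ⟨T', hT', hinj, himg⟩ := exists_injOn_image_eq ω hΞ
  rw [← himg, card_image_of_injOn hinj, himg] at hr
  obtain ⟨J, hJ, hJc⟩ := exists_subset_card_eq hr
  refine ⟨_, mem_Icc.2 ⟨hpos, Nat.le_floor hs⟩, Formula.vars Ξ,
    mem_powersetCard.2 ⟨subset_univ _, rfl⟩, J, mem_powersetCard.2 ⟨hJ.trans hT', hJc⟩, ?_⟩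
  intro i hi
  refine subset_biUnion_of_mem (s := Ξ) (fun c => Constr.vars c) ?_
  rw [← himg]
  exact mem_image_of_mem _ (hJ hi)

/-- The union bound over the variable sets and the choices of constraints. -/
lemma pr_not_sparse_le_sum (hne : 𝒞.Nonempty) (hk : 2 ≤ k) (hkn : k ≤ n) {θ η : ℝ} (hθ : 0 ≤ θ)
    {m : ℕ} (T : Finset (Fin m)) :
    pr (fun ω : Fin m → Constr 𝒞 n => ¬ Formula.Sparse θ η (T.image ω)) ≤
      ∑ s ∈ Icc 1 ⌊η * n⌋₊, (n.choose s : ℝ) * ((#T).choose (excessCount k θ s) : ℝ) *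
        ((s : ℝ) / n) ^ (k * excessCount k θ s) := by
  have := nonempty_constr (n := n) hne hkn
  refine (pr_mono fun ω h => exists_of_not_sparse hk hθ ω T h).trans ?_
  refine (pr_exists_le _ _).trans (Finset.sum_le_sum fun s _ => ?_)
  refine (pr_exists_le _ _).trans ?_
  calc ∑ V ∈ powersetCard s (univ : Finset (Fin n)), pr (fun ω : Fin m → Constr 𝒞 n =>
          ∃ J ∈ powersetCard (excessCount k θ s) T, ∀ i ∈ J, Constr.vars (ω i) ⊆ V)
      ≤ ∑ V ∈ powersetCard s (univ : Finset (Fin n)),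
          ∑ J ∈ powersetCard (excessCount k θ s) T,
            ((s : ℝ) / n) ^ (k * excessCount k θ s) := by
        refine Finset.sum_le_sum fun V hV => (pr_exists_le _ _).trans ?_
        refine Finset.sum_le_sum fun J hJ => ?_
        rw [pr_forall_mem J (fun c : Constr 𝒞 n => Constr.vars c ⊆ V),
          (mem_powersetCard.1 hJ).2, pow_mul]
        have := pr_vars_subset_le (𝒞 := 𝒞) hne hkn (by omega) V
        rw [(mem_powersetCard.1 hV).2] at this
        exact pow_le_pow_left₀ (pr_nonneg _) this _
    _ = _ := by
        simp only [Finset.sum_const, card_powersetCard, card_univ, Fintype.card_fin, nsmul_eq_mul]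
        ring

lemma choose_le_exp_mul_div_pow (N j : ℕ) (hj : 0 < j) :
    (N.choose j : ℝ) ≤ (Real.exp 1 * N / j) ^ j := by
  have h1 := Nat.choose_le_pow_div (α := ℝ) j N
  have h2 := Real.pow_div_factorial_le_exp (j : ℝ) (by positivity) j
  have hf : (0 : ℝ) < (j.factorial : ℝ) := by exact_mod_cast j.factorial_pos
  have hj' : (0 : ℝ) < j := by exact_mod_cast hj
  refine h1.trans ?_
  rw [div_le_iff₀ hf] at h2 ⊢
  rw [div_pow, mul_pow, ← Real.exp_nat_mul, mul_one]
  rw [div_mul_eq_mul_div, le_div_iff₀ (by positivity)]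
  calc (N : ℝ) ^ j * j ^ j ≤ N ^ j * (Real.exp j * j.factorial) := by gcongr
    _ = _ := by ring

/-- The expected number of dense subformulas on `s` variables: the entropy factor `(n / s) ^ s` is
outweighed by `(s / n) ^ ((k - 1) r)`, where `(k - 1) r ≥ (1 + θ) s`. -/
lemma sparse_term_le (hk : 2 ≤ k) {θ c : ℝ} (hθ : 0 < θ) (hθ1 : θ ≤ 1) (hc : 0 < c) {s M : ℕ}
    (hs : 1 ≤ s) (hsn : s ≤ n) (hM : (M : ℝ) ≤ c * n) :
    (n.choose s : ℝ) * (M.choose (excessCount k θ s) : ℝ) *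
        ((s : ℝ) / n) ^ (k * excessCount k θ s) ≤
      (Real.exp 1 * (Real.exp 1 * c * k + 1) ^ 3 * ((s : ℝ) / n) ^ θ) ^ s := by
  have hk2 : (2 : ℝ) ≤ k := by exact_mod_cast hk
  have hs1 : (1 : ℝ) ≤ s := by exact_mod_cast hs
  have hn0 : (0 : ℝ) < n := by exact_mod_cast (by omega : 0 < n)
  set r := excessCount k θ s with hr
  set K := Real.exp 1 * c * k + 1 with hK
  set x := (s : ℝ) / n with hx
  have hx0 : 0 < x := by positivity
  have hx1 : x ≤ 1 := by
    rw [hx, div_le_one hn0]; exact_mod_cast hsn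
  have hK1 : 1 ≤ K := by
    rw [hK]
    have : 0 ≤ Real.exp 1 * c * k := by positivity
    linarith
  have hr0 : 0 < r := Nat.succ_pos _
  have hr0' : (0 : ℝ) < r := by exact_mod_cast hr0
  have hrlow : (1 + θ) * s ≤ ((k : ℝ) - 1) * r := by
    have := Nat.lt_floor_add_one ((1 + θ) * s / ((k : ℝ) - 1))
    rw [div_lt_iff₀ (by linarith)] at this
    rw [hr, excessCount]
    push_cast
    linarith
  have hrup : r ≤ 3 * s := by
    have h1 : (1 + θ) * s / ((k : ℝ) - 1) ≤ (2 * s : ℕ) := by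
      rw [div_le_iff₀ (by linarith)]
      push_cast
      nlinarith
    have h2 := Nat.floor_le_of_le h1
    rw [hr, excessCount]
    omega
  have h1 : (n.choose s : ℝ) ≤ (Real.exp 1 / x) ^ s := by
    refine (choose_le_exp_mul_div_pow n s hs).trans (le_of_eq ?_)
    rw [hx]; congr 1; field_simp
  have h2 : (M.choose r : ℝ) ≤ (K / x) ^ r := by
    refine (choose_le_exp_mul_div_pow M r hr0).trans ?_
    refine pow_le_pow_left₀ (by positivity) ?_ _
    rw [hx, div_div_eq_mul_div, div_le_div_iff₀ hr0' (by positivity)]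
    have h3 : (s : ℝ) ≤ k * r := by nlinarith
    calc Real.exp 1 * M * s ≤ Real.exp 1 * (c * n) * (k * r) := by gcongr
      _ = (K - 1) * n * r := by rw [hK]; ring
      _ ≤ K * n * r := by gcongr; linarith
  have h3 : x ^ ((k - 1) * r) ≤ x ^ s * (x ^ θ) ^ s := by
    rw [← Real.rpow_natCast, ← Real.rpow_natCast, ← Real.rpow_natCast, ← Real.rpow_mul hx0.le,
      ← Real.rpow_add hx0]
    refine Real.rpow_le_rpow_of_exponent_ge hx0 hx1 ?_
    push_cast [Nat.cast_sub (show 1 ≤ k by omega)]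
    linarith
  have hkr : k * r = r + (k - 1) * r := by
    obtain ⟨k', rfl⟩ : ∃ k', k = k' + 1 := ⟨k - 1, by omega⟩
    simp; ring
  have h4 : (Real.exp 1 / x) ^ s * x ^ s = Real.exp 1 ^ s := by
    rw [← mul_pow, div_mul_cancel₀ _ hx0.ne']
  have h5 : (K / x) ^ r * x ^ r = K ^ r := by rw [← mul_pow, div_mul_cancel₀ _ hx0.ne']
  calc (n.choose s : ℝ) * (M.choose r : ℝ) * x ^ (k * r)
      ≤ (Real.exp 1 / x) ^ s * (K / x) ^ r * (x ^ r * (x ^ s * (x ^ θ) ^ s)) := by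
        rw [hkr, pow_add x]
        gcongr
    _ = Real.exp 1 ^ s * K ^ r * (x ^ θ) ^ s := by
        rw [← h4, ← h5]; ring
    _ ≤ Real.exp 1 ^ s * K ^ (3 * s) * (x ^ θ) ^ s := by gcongr
    _ = _ := by rw [pow_mul, mul_pow, mul_pow]

/-- A linear number of random constraints is sparse with high probability. -/
theorem exists_pr_not_sparse_le (hk : 2 ≤ k) (hne : 𝒞.Nonempty) {θ c : ℝ} (hθ : 0 < θ)
    (hθ1 : θ ≤ 1) (hc : 0 < c) :
    ∃ η : ℝ, 0 < η ∧ η ≤ 1 ∧ ∃ B : ℝ, ∀ n, k ≤ n → ∀ (m : ℕ) (T : Finset (Fin m)),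
      (#T : ℝ) ≤ c * n →
      pr (fun ω : Fin m → Constr 𝒞 n => ¬ Formula.Sparse θ η (T.image ω)) ≤
        B * (n : ℝ) ^ (-θ) := by
  set A := Real.exp 1 * (Real.exp 1 * c * k + 1) ^ 3 with hA
  have hA1 : 1 ≤ A := by
    have h1 : (1 : ℝ) ≤ Real.exp 1 := by rw [← Real.exp_zero]; gcongr; norm_num
    have h2 : (1 : ℝ) ≤ (Real.exp 1 * c * k + 1) ^ 3 := by
      refine one_le_pow₀ ?_
      have : 0 ≤ Real.exp 1 * c * k := by positivity
      linarith
    nlinarith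
  have hA0 : 0 < A := by linarith
  -- With this choice of `η`, `A * η ^ θ = 1 / 2`.
  refine ⟨(1 / (2 * A)) ^ (1 / θ), by positivity, ?_, 4 * A, ?_⟩
  · refine Real.rpow_le_one (by positivity) ?_ (by positivity)
    rw [div_le_one (by positivity)]; linarith
  set η := (1 / (2 * A)) ^ (1 / θ) with hη
  have hη0 : 0 < η := by positivity
  have hη1 : η ≤ 1 := by
    refine Real.rpow_le_one (by positivity) ?_ (by positivity)
    rw [div_le_one (by positivity)]; linarith
  have hηθ : A * η ^ θ = 1 / 2 := by
    rw [hη, ← Real.rpow_mul (by positivity), one_div_mul_cancel hθ.ne', Real.rpow_one]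
    field_simp
  intro n hkn m T hT
  have hn : (0 : ℝ) < n := by exact_mod_cast (by omega : 0 < n)
  refine (pr_not_sparse_le_sum hne hk hkn hθ.le T).trans ?_
  have hterm : ∀ s ∈ Icc 1 ⌊η * n⌋₊, (n.choose s : ℝ) * ((#T).choose (excessCount k θ s) : ℝ) *
        ((s : ℝ) / n) ^ (k * excessCount k θ s) ≤
      (2 * A * (n : ℝ) ^ (-θ)) * (s * (1 / 2) ^ s) := by
    intro s hs
    obtain ⟨hs1, hs2⟩ := mem_Icc.1 hs
    have hs3 : (s : ℝ) ≤ η * n := (Nat.le_floor_iff (by positivity)).1 hs2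
    have hsn : s ≤ n := by
      have : (s : ℝ) ≤ n := hs3.trans (mul_le_of_le_one_left hn.le hη1)
      exact_mod_cast this
    have hs1' : (1 : ℝ) ≤ s := by exact_mod_cast hs1
    refine (sparse_term_le hk hθ hθ1 hc hs1 hsn hT).trans ?_
    have hx : ((s : ℝ) / n) ^ θ ≤ η ^ θ := by
      gcongr
      rwa [div_le_iff₀ hn]
    have hx' : ((s : ℝ) / n) ^ θ ≤ s * (n : ℝ) ^ (-θ) := by
      rw [Real.div_rpow (by positivity) hn.le, Real.rpow_neg hn.le, div_eq_mul_inv]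
      gcongr
      calc (s : ℝ) ^ θ ≤ (s : ℝ) ^ (1 : ℝ) := Real.rpow_le_rpow_of_exponent_le hs1' hθ1
        _ = s := Real.rpow_one _
    obtain ⟨t, rfl⟩ : ∃ t, s = t + 1 := ⟨s - 1, by omega⟩
    calc (A * (((t + 1 : ℕ) : ℝ) / n) ^ θ) ^ (t + 1)
        = (A * (((t + 1 : ℕ) : ℝ) / n) ^ θ) ^ t * (A * (((t + 1 : ℕ) : ℝ) / n) ^ θ) := pow_succ _ _
      _ ≤ (1 / 2) ^ t * (A * (((t + 1 : ℕ) : ℝ) * (n : ℝ) ^ (-θ))) := by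
          gcongr
          rw [← hηθ]; gcongr
      _ = _ := by rw [pow_succ]; ring
  refine (Finset.sum_le_sum hterm).trans ?_
  rw [← Finset.mul_sum]
  have hgeo : ∑ s ∈ Icc 1 ⌊η * n⌋₊, ((s : ℝ) * (1 / 2) ^ s) ≤ 2 := by
    have h1 : HasSum (fun s : ℕ => (s : ℝ) * (1 / 2) ^ s) 2 := by
      have := hasSum_coe_mul_geometric_of_norm_lt_one (r := (1 / 2 : ℝ)) (by norm_num)
      rwa [show (1 / 2 : ℝ) / (1 - 1 / 2) ^ 2 = 2 by norm_num] at this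
    exact sum_le_hasSum _ (fun s _ => by positivity) h1
  calc 2 * A * (n : ℝ) ^ (-θ) * ∑ s ∈ Icc 1 ⌊η * n⌋₊, ((s : ℝ) * (1 / 2) ^ s)
      ≤ 2 * A * (n : ℝ) ^ (-θ) * 2 := by gcongr
    _ = _ := by ring

end Sparse

/-! ### Minimally unsatisfiable subformulas and satisfiability -/

section MinimallyUnsatisfiable

variable {k : ℕ} {𝒞 : Finset (Template k)} {n : ℕ}

lemma Formula.exists_minUnsat_subset {Φ : Formula 𝒞 n} (h : ¬ Formula.Sat Φ) :
    ∃ F ⊆ Φ, Formula.MinUnsat F := by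
  induction Φ using Finset.strongInduction with
  | H Φ ih =>
    by_cases hΦ : ∃ Ξ, Ξ ⊂ Φ ∧ ¬ Formula.Sat Ξ
    · obtain ⟨Ξ, hΞ, hs⟩ := hΦ
      obtain ⟨F, hF, hm⟩ := ih Ξ hΞ hs
      exact ⟨F, hF.trans hΞ.subset, hm⟩
    · exact ⟨Φ, Subset.refl _, h, fun Ξ hΞ => by
        by_contra hs
        exact hΦ ⟨Ξ, hΞ, hs⟩⟩

lemma Formula.vars_mono {Φ Ψ : Formula 𝒞 n} (h : Ψ ⊆ Φ) : Formula.vars Ψ ⊆ Formula.vars Φ :=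
  biUnion_subset_biUnion_of_subset_left _ h

/-- A minimally unsatisfiable subformula lies in the spine: each of its constraints completes the
others to an unsatisfiable formula. -/
lemma Formula.MinUnsat.vars_subset_spine {Φ F : Formula 𝒞 n} (hF : Formula.MinUnsat F)
    (h : F ⊆ Φ) : Formula.vars F ⊆ Formula.spine Φ := by
  classical
  intro x hx
  obtain ⟨c, hc, hxc⟩ := mem_biUnion.1 hx
  refine mem_filter.2 ⟨Formula.vars_mono h hx, c, F.erase c, hxc, (erase_subset _ _).trans h,
    hF.2 _ (erase_ssubset hc), ?_⟩
  convert hF.1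
  exact insert_erase hc

lemma Formula.card_vars_le_card_lits (F : Formula 𝒞 n) :
    #(Formula.vars F) ≤ #(Formula.lits F) := by
  have : Formula.vars F = (Formula.lits F).image Prod.fst := by
    rw [Formula.lits, biUnion_image]
    refine biUnion_congr rfl fun c _ => ?_
    rw [image_image]; rfl
  rw [this]
  exact card_image_le

variable (𝒞) in
/-- Every minimally unsatisfiable formula has at least `(1 + ε) / (k - 1)` constraints per distinct
literal. -/
def DenseMinUnsat (ε : ℝ) : Prop :=
  ∀ (n : ℕ) (F : Formula 𝒞 n), Formula.MinUnsat F →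
    (1 + ε) * (#(Formula.lits F) : ℝ) ≤ ((k : ℝ) - 1) * #F

lemma Formula.MinUnsat.lt_card_vars {F Φ : Formula 𝒞 n} {ε θ η : ℝ}
    (hk : 2 ≤ k) (hd : DenseMinUnsat 𝒞 ε) (hε : 0 < ε) (hθ : θ < ε)
    (hΦ : Formula.Sparse θ η Φ) (hF : Formula.MinUnsat F) (h : F ⊆ Φ) :
    η * n < #(Formula.vars F) := by
  by_contra! hle
  have hk2 : (2 : ℝ) ≤ k := by exact_mod_cast hk
  have h1 := hΦ F h hle
  have h2 := hd n F hF
  have h3 : (#(Formula.vars F) : ℝ) ≤ #(Formula.lits F) := by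
    exact_mod_cast Formula.card_vars_le_card_lits F
  have h4 : (0 : ℝ) ≤ #(Formula.vars F) := by positivity
  have h5 : (#(Formula.vars F) : ℝ) = 0 := by nlinarith
  have h6 : (#F : ℝ) = 0 := by
    have : (0 : ℝ) ≤ #F := by positivity
    rw [h5] at h1
    nlinarith
  have h7 : F = ∅ := by simpa using h6
  exact hF.1 ⟨fun _ => true, by simp [h7]⟩

lemma prob_eq_pr (n m : ℕ) (A : Formula 𝒞 n → Prop) :
    prob 𝒞 n m A = pr fun ω : Fin m → Constr 𝒞 n => A (univ.image ω) := by
  rw [pr_eq_card_div, prob]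

lemma tendsto_prob_one {A : ∀ n, Formula 𝒞 n → Prop} {m : ℕ → ℕ} (hne : 𝒞.Nonempty)
    {u : ℕ → ℝ} (hu : Tendsto u atTop (𝓝 0))
    (h : ∀ᶠ n in atTop, pr (fun ω : Fin (m n) → Constr 𝒞 n => ¬ A n (univ.image ω)) ≤ u n) :
    Tendsto (fun n => prob 𝒞 n (m n) (A n)) atTop (𝓝 1) := by
  have h1 : Tendsto (fun n => 1 - u n) atTop (𝓝 1) := by simpa using hu.const_sub 1
  refine tendsto_of_tendsto_of_tendsto_of_le_of_le' h1 tendsto_const_nhds ?_ ?_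
  · filter_upwards [h, eventually_ge_atTop k] with n hn hkn
    have := nonempty_constr (n := n) hne hkn
    rw [pr_not] at hn
    rw [prob_eq_pr]
    linarith
  · refine Eventually.of_forall fun n => ?_
    rw [prob_eq_pr]
    exact pr_le_one _

end MinimallyUnsatisfiable

section Satisfiability

variable {k : ℕ} {𝒞 : Finset (Template k)} {n : ℕ}

open Classical in
/-- The number of constraints in an unsatisfiable formula exceeds what a hyperforest on its
literals can hold, so many constraints close cycles or come late. -/
lemma lt_card_closesCycle_add (hk : 2 ≤ k) {ε θ η : ℝ} (hε : 0 < ε) (hθ : θ < ε)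
    (hd : DenseMinUnsat 𝒞 ε) {m : ℕ} (M : ℕ) (ω : Fin m → Constr 𝒞 n)
    (hsp : Formula.Sparse θ η (univ.image ω)) (hsat : ¬ Formula.Sat (univ.image ω)) :
    ε * (η * n) < ((k : ℝ) - 1) *
      (#{j ∈ univ.filter (fun j : Fin m => (j : ℕ) < M) |
        ClosesCycle (fun i => Constr.lits (ω i)) j} + (m - M : ℕ)) := by
  obtain ⟨F, hF, hmin⟩ := Formula.exists_minUnsat_subset hsat
  have hk2 : (2 : ℝ) ≤ k := by exact_mod_cast hk
  have h1 := hmin.lt_card_vars hk hd hε hθ hsp hF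
  have h2 := hd n F hmin
  have h3 : (#(Formula.vars F) : ℝ) ≤ #(Formula.lits F) := by
    exact_mod_cast Formula.card_vars_le_card_lits F
  obtain ⟨I, -, hinj, himg⟩ := exists_injOn_image_eq ω hF
  have hcard : #I = #F := by rw [← himg, card_image_of_injOn hinj]
  set Bad := {j ∈ univ.filter (fun j : Fin m => (j : ℕ) < M) |
    ClosesCycle (fun i => Constr.lits (ω i)) j} with hBad
  set I' := I.filter fun j : Fin m => (j : ℕ) < M ∧ ¬ ClosesCycle (fun i => Constr.lits (ω i)) j
    with hI'
  have h4 : (k - 1) * #I' ≤ #(I'.biUnion fun i => Constr.lits (ω i)) :=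
    mul_card_le_card_biUnion (by omega) I' (fun j _ => Constr.card_lits _)
      fun j hj => (mem_filter.1 hj).2.2
  have h5 : (I'.biUnion fun i => Constr.lits (ω i)) ⊆ Formula.lits F := by
    intro l hl
    obtain ⟨i, hi, hl⟩ := mem_biUnion.1 hl
    refine mem_biUnion.2 ⟨ω i, ?_, hl⟩
    rw [← himg]
    exact mem_image_of_mem _ (mem_filter.1 hi).1
  have h6 : ((k : ℝ) - 1) * #I' ≤ #(Formula.lits F) := by
    have : ((k - 1 : ℕ) : ℝ) * #I' ≤ #(Formula.lits F) := by
      exact_mod_cast h4.trans (card_le_card h5)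
    rwa [Nat.cast_sub (by omega), Nat.cast_one] at this
  have h7 : I ⊆ (I' ∪ Bad) ∪ univ.filter (fun j : Fin m => M ≤ (j : ℕ)) := by
    intro j hj
    simp only [hI', hBad, mem_union, mem_filter, mem_univ, true_and]
    rcases lt_or_ge (j : ℕ) M with h | h
    · by_cases hc : ClosesCycle (fun i => Constr.lits (ω i)) j <;> simp [h, hj, hc]
    · simp [h]
  have h8 : #(univ.filter fun j : Fin m => M ≤ (j : ℕ)) ≤ m - M := by
    calc #(univ.filter fun j : Fin m => M ≤ (j : ℕ)) ≤ #(Ico M m) := by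
          refine card_le_card_of_injOn (fun j => (j : ℕ)) ?_ Fin.val_injective.injOn
          intro j hj
          simpa using hj
      _ = m - M := by simp
  have h9 : (#F : ℝ) ≤ #I' + #Bad + (m - M : ℕ) := by
    rw [← hcard]
    norm_cast
    refine (card_le_card h7).trans ((card_union_le _ _).trans (add_le_add (card_union_le _ _) h8))
  nlinarith

/-- Random formulas are satisfiable even slightly above the density `2 / (k (k - 1))`: the
constraints beyond the subcritical regime are too few to supply the excess of constraints that a
minimally unsatisfiable formula of linear size needs. -/
theorem exists_tendsto_prob_sat (hk : 2 ≤ k) (hne : 𝒞.Nonempty) {ε : ℝ} (hε : 0 < ε)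
    (hd : DenseMinUnsat 𝒞 ε) :
    ∃ δ : ℝ, 0 < δ ∧ ∀ m : ℕ → ℕ,
      (∀ n, (m n : ℝ) ≤ 2 / ((k : ℝ) * ((k : ℝ) - 1)) * (1 + δ) * n) →
        Tendsto (fun n => prob 𝒞 n (m n) fun Φ => Formula.Sat Φ) atTop (𝓝 1) := by
  classical
  have hk2 : (2 : ℝ) ≤ k := by exact_mod_cast hk
  have hk1 : (0 : ℝ) < (k : ℝ) - 1 := by linarith
  have hk0 : (0 : ℝ) < k := by linarith
  -- The critical density, at which the branching process in `sum_pr_conn_le` has mean offspring 1.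
  set c₀ : ℝ := 2 / ((k : ℝ) * ((k : ℝ) - 1)) with hc₀
  have hc₀pos : 0 < c₀ := by positivity
  set θ : ℝ := min (ε / 2) 1 with hθ
  have hθ0 : 0 < θ := by positivity
  have hθε : θ < ε := (min_le_left _ _).trans_lt (by linarith)
  obtain ⟨η, hη, -, B, hB⟩ := exists_pr_not_sparse_le (𝒞 := 𝒞) hk hne hθ0 (min_le_right _ _)
    (show 0 < c₀ * 2 by positivity)
  -- The `2 δ c₀ n` constraints beyond density `(1 - δ) c₀` contribute at most `ε η n / 4` to the
  -- excess, so that closed cycles have to make up for a fixed proportion of it.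
  set δ : ℝ := min (1 / 2) (ε * η / 8) with hδ
  have hδ0 : 0 < δ := by positivity
  have hδ1 : δ ≤ 1 / 2 := min_le_left _ _
  have hδ2 : δ ≤ ε * η / 8 := min_le_right _ _
  refine ⟨δ, hδ0, fun m hm => ?_⟩
  set t : ℝ := ε * η / (2 * ((k : ℝ) - 1)) with ht
  have ht0 : 0 < t := by positivity
  refine tendsto_prob_one (u := fun n : ℕ => B * (n : ℝ) ^ (-θ) + 1 / (δ * t) * (1 / ((n : ℝ) - 1)))
    hne ?_ ?_
  · have h1 : Tendsto (fun n : ℕ => B * (n : ℝ) ^ (-θ)) atTop (𝓝 (B * 0)) :=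
      ((tendsto_rpow_neg_atTop hθ0).comp tendsto_natCast_atTop_atTop).const_mul B
    have h2 : Tendsto (fun n : ℕ => 1 / (δ * t) * (1 / ((n : ℝ) - 1))) atTop
        (𝓝 (1 / (δ * t) * 0)) := by
      refine Tendsto.const_mul _ ?_
      simp only [one_div]
      exact tendsto_inv_atTop_zero.comp
        (tendsto_atTop_add_const_right _ (-1) tendsto_natCast_atTop_atTop)
    simpa using h1.add h2
  · have hlarge : ∀ᶠ n : ℕ in atTop, ((k : ℝ) - 1) * 4 / (ε * η) ≤ n :=
      tendsto_natCast_atTop_atTop.eventually_ge_atTop _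
    filter_upwards [hlarge, eventually_ge_atTop k] with n hn hkn
    have hn2 : (2 : ℝ) ≤ n := by exact_mod_cast hk.trans hkn
    have hn0 : (0 : ℝ) < n := by linarith
    have hn1 : (0 : ℝ) < (n : ℝ) - 1 := by linarith
    rw [div_le_iff₀ (by positivity)] at hn
    set M : ℕ := ⌊c₀ * (1 - δ) * n⌋₊ with hM
    have hMle : (M : ℝ) ≤ c₀ * (1 - δ) * n := by
      refine Nat.floor_le ?_
      have : 0 ≤ 1 - δ := by linarith
      positivity
    have hMlt : c₀ * (1 - δ) * n < M + 1 := Nat.lt_floor_add_one _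
    have hc₀k : ((k : ℝ) - 1) * c₀ * k = 2 := by rw [hc₀]; field_simp
    have hc₀k' : ((k : ℝ) - 1) * c₀ ≤ 1 := by nlinarith [mul_pos hk1 hc₀pos]
    have hrest : ((k : ℝ) - 1) * (m n - M : ℕ) ≤ ε * η / 2 * n := by
      have h1 : ((m n - M : ℕ) : ℝ) ≤ c₀ * (2 * δ) * n + 1 := by
        rcases le_total M (m n) with h | h
        · rw [Nat.cast_sub h]
          have := hm n
          linarith
        · rw [Nat.sub_eq_zero_of_le h]
          simp only [Nat.cast_zero]
          positivity
      calc ((k : ℝ) - 1) * (m n - M : ℕ) ≤ ((k : ℝ) - 1) * (c₀ * (2 * δ) * n + 1) := by gcongr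
        _ = (((k : ℝ) - 1) * c₀) * (2 * δ) * n + ((k : ℝ) - 1) := by ring
        _ ≤ 1 * (2 * (ε * η / 8)) * n + ε * η / 4 * n := by
            gcongr
            linarith
        _ = _ := by ring
    have hsub : ∀ ω : Fin (m n) → Constr 𝒞 n, ¬ Formula.Sat (univ.image ω) →
        ¬ Formula.Sparse θ η (univ.image ω) ∨
          t * n ≤ (#{j ∈ univ.filter (fun j : Fin (m n) => (j : ℕ) < M) |
            ClosesCycle (fun i => Constr.lits (ω i)) j} : ℝ) := by
      intro ω hω
      by_cases hsp : Formula.Sparse θ η (univ.image ω)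
      · right
        have h1 := lt_card_closesCycle_add hk hε hθε hd M ω hsp hω
        rw [mul_add] at h1
        rw [ht, div_mul_eq_mul_div, div_le_iff₀ (by positivity)]
        linarith
      · exact Or.inl hsp
    refine (pr_mono hsub).trans ((pr_or_le _ _).trans (add_le_add ?_ ?_))
    · refine hB n hkn (m n) univ ?_
      rw [card_univ, Fintype.card_fin]
      refine (hm n).trans ?_
      gcongr
      linarith
    · refine (pr_le_card_div _ _ (by positivity)).trans ?_
      have hsum : ∑ j ∈ univ.filter (fun j : Fin (m n) => (j : ℕ) < M),
          pr (fun ω : Fin (m n) → Constr 𝒞 n => ClosesCycle (fun i => Constr.lits (ω i)) j) ≤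
          M * ((k * (k - 1) : ℝ) / (2 * (n - 1) * δ)) := by
        have hcard : #(univ.filter (fun j : Fin (m n) => (j : ℕ) < M)) ≤ M := by
          calc _ ≤ #(range M) := by
                refine card_le_card_of_injOn (fun j => (j : ℕ)) ?_ Fin.val_injective.injOn
                intro j hj
                simpa using hj
            _ = M := by simp
        calc _ ≤ ∑ j ∈ univ.filter (fun j : Fin (m n) => (j : ℕ) < M),
              ((k * (k - 1) : ℝ) / (2 * (n - 1) * δ)) := by
              refine Finset.sum_le_sum fun j hj => ?_
              refine pr_closesCycle_le hne hkn (by omega) (by omega) hδ0 j ?_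
              have hjM : ((j : ℕ) : ℝ) ≤ M := by exact_mod_cast (mem_filter.1 hj).2.le
              calc ((j : ℕ) : ℝ) * ((k * (k - 1) : ℝ) / (2 * n))
                  ≤ (c₀ * (1 - δ) * n) * ((k * (k - 1) : ℝ) / (2 * n)) := by
                    gcongr
                    linarith
                _ = 1 - δ := by rw [hc₀]; field_simp
          _ ≤ _ := by
              rw [Finset.sum_const, nsmul_eq_mul]
              gcongr
      rw [div_le_iff₀ (by positivity)]
      refine hsum.trans ?_
      calc M * ((k * (k - 1) : ℝ) / (2 * (n - 1) * δ))
          ≤ (c₀ * n) * ((k * (k - 1) : ℝ) / (2 * (n - 1) * δ)) := by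
            gcongr
            refine hMle.trans ?_
            gcongr
            nlinarith
        _ = 1 / (δ * t) * (1 / ((n : ℝ) - 1)) * (t * n) := by
            rw [hc₀]; field_simp

end Satisfiability

/-! ### The spine -/

section Spine

variable {k : ℕ} {𝒞 : Finset (Template k)} {n : ℕ}

lemma Good.negate_injective (hgood : Good 𝒞) {R : Template k} (hR : R ∈ 𝒞) :
    Function.Injective (negate R) := by
  have hinj : Set.InjOn (fun q : Template k × (Fin k → Bool) => negate q.1 q.2)
      (𝒞 ×ˢ (univ : Finset (Fin k → Bool)) : Finset _) := by
    refine card_image_iff.1 (hgood.trans ?_)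
    simp [card_product]
  intro e e' h
  have := hinj (show (R, e) ∈ _ by simp [hR]) (show (R, e') ∈ _ by simp [hR]) h
  exact congrArg Prod.snd this

lemma Good.exists_notMem (hk : 1 ≤ k) (hgood : Good 𝒞) {R : Template k} (hR : R ∈ 𝒞) :
    ∃ x, x ∉ R := by
  by_contra! h
  have := Good.negate_injective hgood hR (a₁ := fun _ => true) (a₂ := fun _ => false)
    (by simp [negate, h])
  simpa using congrFun this ⟨0, hk⟩

/-- Some choice of the signs of a constraint makes it violated by a given assignment. -/
lemma pr_satBy_le (hk : 1 ≤ k) (hne : 𝒞.Nonempty) (hgood : Good 𝒞) (hkn : k ≤ n)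
    (a : Fin n → Bool) :
    pr (fun c : Constr 𝒞 n => Constr.SatBy c a) ≤ 1 - (1 / 2 : ℝ) ^ k := by
  classical
  have := nonempty_constr (n := n) hne hkn
  choose t ht using fun R : {R : Template k // R ∈ 𝒞} => Good.exists_notMem hk hgood R.2
  have hd : 0 < n.descFactorial k := Nat.descFactorial_pos.2 hkn
  have hC : 0 < #𝒞 := card_pos.2 hne
  suffices h : (1 / 2 : ℝ) ^ k ≤ pr (fun c : Constr 𝒞 n => ¬ Constr.SatBy c a) by
    rw [pr_not] at h; linarith
  rw [pr_eq_card_div, card_constr, le_div_iff₀ (by positivity)]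
  have h1 : (1 / 2 : ℝ) ^ k * ((n.descFactorial k * (2 ^ k * #𝒞) : ℕ) : ℝ) =
      ((n.descFactorial k * #𝒞 : ℕ) : ℝ) := by
    push_cast
    rw [one_div, inv_pow]
    field_simp
  have h2 : n.descFactorial k * #𝒞 =
      #(univ : Finset ((Fin k ↪ Fin n) × {R : Template k // R ∈ 𝒞})) := by
    simp [Fintype.card_embedding_eq]
  rw [h1, h2, Nat.cast_le]
  refine card_le_card_of_injOn (fun q => (q.1, fun i => a (q.1 i) == t q.2 i, q.2)) ?_ ?_
  · rintro ⟨f, R⟩ -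
    refine mem_coe.2 ((@mem_filter _ _ (_) _ _).2 ⟨mem_univ _, ?_⟩)
    have : (fun i => litVal a (Constr.lit ((f, fun i => a (f i) == t R i, R) : Constr 𝒞 n) i)) =
        t R := by
      funext i
      simp only [litVal, Constr.lit]
      cases a (f i) <;> cases t R i <;> rfl
    rw [Constr.SatBy, this]
    exact ht R
  · rintro ⟨f, R⟩ - ⟨f', R'⟩ - h
    simp only [Prod.mk.injEq] at h
    exact Prod.ext h.1 h.2.2

lemma pr_sat_image_le (hk : 1 ≤ k) (hne : 𝒞.Nonempty) (hgood : Good 𝒞) (hkn : k ≤ n) {m : ℕ}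
    (T : Finset (Fin m)) :
    pr (fun ω : Fin m → Constr 𝒞 n => Formula.Sat (T.image ω)) ≤
      2 ^ n * (1 - (1 / 2 : ℝ) ^ k) ^ #T := by
  have := nonempty_constr (n := n) hne hkn
  calc pr (fun ω : Fin m → Constr 𝒞 n => Formula.Sat (T.image ω))
      ≤ pr (fun ω : Fin m → Constr 𝒞 n => ∃ a ∈ (univ : Finset (Fin n → Bool)),
          ∀ i ∈ T, Constr.SatBy (ω i) a) := by
        refine pr_mono ?_
        rintro ω ⟨a, ha⟩
        exact ⟨a, mem_univ _, fun i hi => ha _ (mem_image_of_mem _ hi)⟩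
    _ ≤ ∑ a : Fin n → Bool, (1 - (1 / 2 : ℝ) ^ k) ^ #T := by
        refine (pr_exists_le _ _).trans (Finset.sum_le_sum fun a _ => ?_)
        rw [pr_forall_mem T fun c : Constr 𝒞 n => Constr.SatBy c a]
        exact pow_le_pow_left₀ (pr_nonneg _) (pr_satBy_le hk hne hgood hkn a) _
    _ = _ := by
        rw [Finset.sum_const, card_univ, Fintype.card_fun, Fintype.card_fin, Fintype.card_bool,
          nsmul_eq_mul]
        push_cast; rfl

lemma Formula.spine_mono {Φ Ψ : Formula 𝒞 n} (h : Ψ ⊆ Φ) :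
    Formula.spine Ψ ⊆ Formula.spine Φ := by
  classical
  intro x hx
  obtain ⟨hx1, c, Ξ, hc, hΞ, hs⟩ := mem_filter.1 hx
  exact mem_filter.2 ⟨Formula.vars_mono h hx1, c, Ξ, hc, hΞ.trans h, hs⟩

/-- The first linearly many constraints are already unsatisfiable with high probability, and a
minimally unsatisfiable subformula of a sparse formula has linearly many variables, all of which
are in the spine. -/
theorem discontinuousSpine_of_dense (hk : 2 ≤ k) (hne : 𝒞.Nonempty) (hgood : Good 𝒞) {ε : ℝ}
    (hε : 0 < ε) (hd : DenseMinUnsat 𝒞 ε) : DiscontinuousSpine 𝒞 := by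
  classical
  have hq1 : (1 - (1 / 2 : ℝ) ^ k) < 1 := by
    have : (0 : ℝ) < (1 / 2) ^ k := by positivity
    linarith
  have hq0 : (0 : ℝ) ≤ 1 - (1 / 2 : ℝ) ^ k := by
    have : (1 / 2 : ℝ) ^ k ≤ 1 := pow_le_one₀ (by norm_num) (by norm_num)
    linarith
  -- With `N * n` constraints, the expected number of satisfying assignments is at most `2⁻ⁿ`.
  obtain ⟨N, hN⟩ := exists_pow_lt_of_lt_one (show (0 : ℝ) < 1 / 4 by norm_num) hq1
  set θ : ℝ := min (ε / 2) 1 with hθ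
  have hθ0 : 0 < θ := by positivity
  have hθε : θ < ε := (min_le_left _ _).trans_lt (by linarith)
  obtain ⟨η, hη, -, B, hB⟩ := exists_pr_not_sparse_le (𝒞 := 𝒞) hk hne hθ0 (min_le_right _ _)
    (show (0 : ℝ) < N + 1 by positivity)
  refine ⟨η, hη, fun m hm => ?_⟩
  refine tendsto_prob_one (u := fun n : ℕ => B * (n : ℝ) ^ (-θ) +
    ((prob 𝒞 n (m n) fun Φ => Formula.Sat Φ) + (1 / 2) ^ n)) hne ?_ ?_
  · have h1 : Tendsto (fun n : ℕ => B * (n : ℝ) ^ (-θ)) atTop (𝓝 (B * 0)) :=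
      ((tendsto_rpow_neg_atTop hθ0).comp tendsto_natCast_atTop_atTop).const_mul B
    have h2 : Tendsto (fun n : ℕ => (1 / 2 : ℝ) ^ n) atTop (𝓝 0) :=
      tendsto_pow_atTop_nhds_zero_of_lt_one (by norm_num) (by norm_num)
    simpa using h1.add (hm.add h2)
  · filter_upwards [eventually_ge_atTop k] with n hkn
    have hn0 : (0 : ℝ) < n := by exact_mod_cast (by omega : 0 < n)
    set T : Finset (Fin (m n)) := univ.filter fun j : Fin (m n) => (j : ℕ) < N * n with hT
    have hTcard : #T = min (m n) (N * n) := by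
      rw [hT, Fin.card_filter_val_lt]
    have hsub : ∀ ω : Fin (m n) → Constr 𝒞 n,
        ¬ η ≤ Formula.spineFraction (univ.image ω) →
        ¬ Formula.Sparse θ η (T.image ω) ∨ Formula.Sat (T.image ω) := by
      intro ω hω
      by_contra! hcon
      obtain ⟨hsp, hsat⟩ := hcon
      obtain ⟨F, hF, hmin⟩ := Formula.exists_minUnsat_subset hsat
      have h1 := hmin.lt_card_vars hk hd hε hθε hsp hF
      have h2 : #(Formula.vars F) ≤ #(Formula.spine (univ.image ω)) :=
        card_le_card ((hmin.vars_subset_spine hF).trans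
          (Formula.spine_mono (image_subset_image (subset_univ _))))
      refine hω ?_
      rw [Formula.spineFraction, le_div_iff₀ hn0]
      exact h1.le.trans (by exact_mod_cast h2)
    refine (pr_mono hsub).trans ((pr_or_le _ _).trans (add_le_add ?_ ?_))
    · refine hB n hkn (m n) T ?_
      calc (#T : ℝ) ≤ (N * n : ℕ) := by
            rw [hTcard]; exact_mod_cast min_le_right _ _
        _ ≤ _ := by push_cast; nlinarith
    · rcases le_total (m n) (N * n) with h | h
      · have hTu : T = univ := by
          rw [← card_eq_iff_eq_univ, hTcard, min_eq_left h, Fintype.card_fin]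
        rw [hTu, prob_eq_pr]
        have : (0 : ℝ) ≤ (1 / 2) ^ n := by positivity
        linarith
      · refine (pr_sat_image_le (by omega) hne hgood hkn T).trans ?_
        rw [hTcard, min_eq_right h, pow_mul, ← mul_pow]
        have h0 : 0 ≤ prob 𝒞 n (m n) fun Φ => Formula.Sat Φ := by
          rw [prob_eq_pr]; exact pr_nonneg _
        have h1 : (2 * (1 - (1 / 2 : ℝ) ^ k) ^ N) ^ n ≤ (1 / 2 : ℝ) ^ n := by
          gcongr
          linarith
        linarith

end Spine

/-! ### Size and width of resolution refutations -/

section SizeWidth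

variable {n : ℕ}

/-- The opposite literal. -/
def Literal.neg (l : Literal n) : Literal n := (l.1, !l.2)

/-- The set of opposite literals. -/
def negLits (ρ : Finset (Literal n)) : Finset (Literal n) := ρ.image Literal.neg

lemma Literal.neg_neg (l : Literal n) : Literal.neg (Literal.neg l) = l := by
  simp [Literal.neg]

lemma mem_negLits {ρ : Finset (Literal n)} {l : Literal n} :
    l ∈ negLits ρ ↔ Literal.neg l ∈ ρ := by
  constructor
  · intro h
    obtain ⟨l', hl', rfl⟩ := mem_image.1 h
    rwa [Literal.neg_neg]
  · intro h
    exact mem_image.2 ⟨_, h, Literal.neg_neg l⟩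

/-- `Derives Γ ρ w C`: the clause `C` can be derived in width at most `w`, by resolution with
weakening, from the clause set `Γ` restricted by `ρ`, that is, from the clauses of `Γ` without
literals in `ρ`, in which the literals opposite to those in `ρ` are deleted. -/
inductive Derives (Γ : Finset (Clause n)) (ρ : Finset (Literal n)) (w : ℕ) : Clause n → Prop
  | ax {A C : Clause n} (hA : A ∈ Γ) (hρ : Disjoint A ρ) (hAC : A \ negLits ρ ⊆ C)
      (hw : #C ≤ w) : Derives Γ ρ w C
  | weaken {C D : Clause n} (hC : Derives Γ ρ w C) (hCD : C ⊆ D) (hw : #D ≤ w) : Derives Γ ρ w D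
  | resolve {C : Clause n} (l : Literal n) (h₁ : Derives Γ ρ w (insert l C))
      (h₂ : Derives Γ ρ w (insert (Literal.neg l) C)) (hw : #C ≤ w) : Derives Γ ρ w C

variable {Γ : Finset (Clause n)} {ρ : Finset (Literal n)} {w : ℕ} {C : Clause n}

lemma negLits_insert (l : Literal n) : negLits (insert l ρ) = insert (Literal.neg l) (negLits ρ) :=
  image_insert _ _ _

/-- A derivation under the assumption `l` becomes a derivation of the implication from `l`. -/
lemma Derives.insert_neg {l : Literal n} (h : Derives Γ (insert l ρ) w C) :
    Derives Γ ρ (w + 1) (insert (Literal.neg l) C) := by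
  have hcard : ∀ D : Clause n, #D ≤ w → #(insert (Literal.neg l) D) ≤ w + 1 := fun D hD =>
    (card_insert_le _ _).trans (by omega)
  induction h with
  | ax hA hρ hAC hC =>
    refine .ax hA (hρ.mono_right (subset_insert _ _)) ?_ (hcard _ hC)
    intro x hx
    rw [negLits_insert] at hAC
    by_cases hxl : x = Literal.neg l
    · simp [hxl]
    · refine mem_insert_of_mem (hAC ?_)
      simp only [Finset.mem_sdiff, mem_insert, not_or] at hx ⊢
      exact ⟨hx.1, hxl, hx.2⟩
  | weaken _ hCD hD ih => exact .weaken ih (insert_subset_insert _ hCD) (hcard _ hD)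
  | resolve l' _ _ hC ih₁ ih₂ =>
    rw [insert_comm] at ih₁ ih₂
    exact .resolve l' ih₁ ih₂ (hcard _ hC)

/-- When the literal `l` is derived, it may be assumed. -/
lemma Derives.of_insert {l : Literal n} {w₀ : ℕ} (hΓ : ∀ A ∈ Γ, #A ≤ w₀) (hw : w₀ ≤ w)
    (hl : Derives Γ ρ w {l}) (h : Derives Γ (insert l ρ) w C) : Derives Γ ρ w C := by
  induction h with
  | @ax A C hA hρ hAC hC =>
    rw [disjoint_insert_right] at hρ
    rw [negLits_insert] at hAC
    have hB : #(A \ negLits ρ) ≤ w := (card_le_card sdiff_subset).trans ((hΓ A hA).trans hw)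
    have hDC : (A \ negLits ρ).erase (Literal.neg l) ⊆ C := by
      intro x hx
      refine hAC ?_
      simp only [mem_erase, Finset.mem_sdiff, mem_insert, not_or] at hx ⊢
      tauto
    by_cases hmem : Literal.neg l ∈ A \ negLits ρ
    · have hcard := card_erase_add_one hmem
      refine .weaken (C := (A \ negLits ρ).erase (Literal.neg l)) ?_ hDC hC
      refine .resolve l (.weaken hl (by simp) ?_) ?_ (by omega)
      · exact (card_insert_le _ _).trans (by omega)
      · rw [insert_erase hmem]
        exact .ax hA hρ.2 (Subset.refl _) hB
    · rw [erase_eq_of_notMem hmem] at hDC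
      exact .ax hA hρ.2 hDC hC
  | weaken _ hCD hD ih => exact .weaken ih hCD hD
  | resolve l' _ _ hC ih₁ ih₂ => exact .resolve l' ih₁ ih₂ hC

/-- The clauses in `P` that are not satisfied by `ρ` and have more than `d` literals left. -/
def fatClauses (P : Finset (Clause n)) (d : ℕ) (ρ : Finset (Literal n)) : Finset (Clause n) :=
  {C ∈ P | Disjoint C ρ ∧ d < #(C \ negLits ρ)}

/-- A refutation without fat clauses, restricted by a consistent set of literals, is a narrow
refutation. -/
lemma Derives.of_fatClauses_eq_empty {π : List (Clause n)} (hπ : IsRefutation Γ π) {d : ℕ}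
    (hρ : ∀ l ∈ ρ, Literal.neg l ∉ ρ) (hfat : fatClauses π.toFinset d ρ = ∅) (hw : d + 1 ≤ w) :
    Derives Γ ρ w ∅ := by
  have hnarrow : ∀ C ∈ π, Disjoint C ρ → #(C \ negLits ρ) ≤ d := by
    intro C hC hCρ
    by_contra! hlt
    have : C ∈ fatClauses π.toFinset d ρ := mem_filter.2 ⟨List.mem_toFinset.2 hC, hCρ, hlt⟩
    simp [hfat] at this
  have key : ∀ (N : ℕ) (i : Fin π.length), (i : ℕ) = N → Disjoint (π.get i) ρ →
      Derives Γ ρ w (π.get i \ negLits ρ) := by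
    intro N
    induction N using Nat.strong_induction_on with
    | _ N ih =>
      intro i hi hdisj
      have hE := hnarrow _ (List.get_mem π i) hdisj
      rcases hπ.1 i with hΓ | ⟨j, l, hj, hl, v, hvj, hvl, hres⟩
      · exact .ax hΓ hdisj (Subset.refl _) (by omega)
      have ihj := ih j (by omega) j rfl
      have ihl := ih l (by omega) l rfl
      rw [hres] at hdisj hE ⊢
      generalize π.get j = C at *
      generalize π.get l = D at *
      obtain ⟨hCρ, hDρ⟩ := disjoint_union_left.1 hdisj
      have hC : (v, true) ∉ ρ → Disjoint C ρ := fun h => by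
        rw [← insert_erase hvj, disjoint_insert_left]; exact ⟨h, hCρ⟩
      have hD : (v, false) ∉ ρ → Disjoint D ρ := fun h => by
        rw [← insert_erase hvl, disjoint_insert_left]; exact ⟨h, hDρ⟩
      by_cases h1 : (v, true) ∈ ρ
      · refine .weaken (ihl (hD (hρ _ h1))) ?_ (by omega)
        intro x hx
        obtain ⟨hx1, hx2⟩ := mem_sdiff.1 hx
        refine mem_sdiff.2 ⟨mem_union_right _ (mem_erase.2 ⟨?_, hx1⟩), hx2⟩
        rintro rfl
        exact hx2 (mem_negLits.2 h1)
      by_cases h2 : (v, false) ∈ ρ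
      · refine .weaken (ihj (hC h1)) ?_ (by omega)
        intro x hx
        obtain ⟨hx1, hx2⟩ := mem_sdiff.1 hx
        refine mem_sdiff.2 ⟨mem_union_left _ (mem_erase.2 ⟨?_, hx1⟩), hx2⟩
        rintro rfl
        exact hx2 (mem_negLits.2 h2)
      refine .resolve (v, true) (.weaken (ihj (hC h1)) ?_ ?_) (.weaken (ihl (hD h2)) ?_ ?_)
        (by omega)
      · intro x hx
        obtain ⟨hx1, hx2⟩ := mem_sdiff.1 hx
        by_cases hxv : x = (v, true)
        · simp [hxv]
        · exact mem_insert_of_mem (mem_sdiff.2 ⟨mem_union_left _ (mem_erase.2 ⟨hxv, hx1⟩), hx2⟩)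
      · exact (card_insert_le _ _).trans (by omega)
      · intro x hx
        obtain ⟨hx1, hx2⟩ := mem_sdiff.1 hx
        by_cases hxv : x = (v, false)
        · simp [hxv, Literal.neg]
        · exact mem_insert_of_mem (mem_sdiff.2 ⟨mem_union_right _ (mem_erase.2 ⟨hxv, hx1⟩), hx2⟩)
      · exact (card_insert_le _ _).trans (by omega)
  obtain ⟨i, hi⟩ := List.get_of_mem hπ.2
  have := key i i rfl (by rw [hi]; exact disjoint_empty_left _)
  rwa [hi, empty_sdiff] at this

/-- Some literal occurs in at least the average number of fat clauses. -/
lemma exists_frequent_literal {S : Finset (Clause n)} (hS : S.Nonempty) {d : ℕ}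
    (hd : ∀ C ∈ S, d < #(C \ negLits ρ)) :
    ∃ l, d * #S < 2 * n * #{C ∈ S | l ∈ C \ negLits ρ} := by
  classical
  have hdouble : ∑ l : Literal n, #{C ∈ S | l ∈ C \ negLits ρ} = ∑ C ∈ S, #(C \ negLits ρ) := by
    simp only [card_filter]
    rw [sum_comm]
    refine sum_congr rfl fun C _ => ?_
    rw [← card_filter]
    congr 1
    ext x
    simp
  have hn : 0 < n := by
    obtain ⟨C, hC⟩ := hS
    have h1 := hd C hC
    obtain ⟨l, -⟩ := card_pos.1 (by omega : 0 < #(C \ negLits ρ))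
    exact l.1.pos
  have hlt : ∑ l : Literal n, d * #S < ∑ l : Literal n, 2 * n * #{C ∈ S | l ∈ C \ negLits ρ} := by
    calc ∑ l : Literal n, d * #S = 2 * n * ∑ C ∈ S, d := by
          simp [Fintype.card_prod]; ring
      _ < 2 * n * ∑ C ∈ S, #(C \ negLits ρ) :=
          Nat.mul_lt_mul_of_pos_left (sum_lt_sum_of_nonempty hS hd) (by omega)
      _ = _ := by rw [← hdouble, mul_sum]
  obtain ⟨l, -, hl⟩ := exists_lt_of_sum_lt hlt
  exact ⟨l, hl⟩

/-- The size-width relation of Ben-Sasson and Wigderson: a refutation with few fat clauses can be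
turned into a narrow one. The most frequent literal `l` of the fat clauses is assumed, which
satisfies a fraction `d / (2 n)` of them, and then refuted under its negation. -/
theorem Derives.empty_of_isRefutation {π : List (Clause n)} (hπ : IsRefutation Γ π) {w₀ : ℕ}
    (hΓ : ∀ A ∈ Γ, #A ≤ w₀) {d : ℕ} (hd : d ≤ 2 * n) (b : ℕ) (hρ : ∀ l ∈ ρ, Literal.neg l ∉ ρ)
    (hb : (#(fatClauses π.toFinset d ρ) : ℝ) * (1 - d / (2 * n)) ^ b < 1) :
    Derives Γ ρ (d + 1 + w₀ + b) ∅ := by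
  induction hN : 2 * n - #ρ using Nat.strong_induction_on generalizing ρ b with
  | _ N ih =>
  rcases (fatClauses π.toFinset d ρ).eq_empty_or_nonempty with hfat | hfat
  · exact Derives.of_fatClauses_eq_empty hπ hρ hfat (by omega)
  obtain ⟨l, hl⟩ := exists_frequent_literal hfat (ρ := ρ) (d := d) fun C hC => (mem_filter.1 hC).2.2
  obtain ⟨C, hC⟩ := card_pos.1 (Nat.pos_of_mul_pos_left (by omega :
    0 < 2 * n * #{C ∈ fatClauses π.toFinset d ρ | l ∈ C \ negLits ρ}))
  obtain ⟨hC1, hC2⟩ := mem_filter.1 hC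
  obtain ⟨hlC, hlneg⟩ := mem_sdiff.1 hC2
  have hlρ : l ∉ ρ := disjoint_left.1 (mem_filter.1 hC1).2.1 hlC
  have hlρ' : Literal.neg l ∉ ρ := fun h => hlneg (mem_negLits.2 h)
  have hne : ∀ l : Literal n, Literal.neg l ≠ l := fun l h => by
    have := congrArg Prod.snd h
    simp [Literal.neg] at this
  have hcons : ∀ l : Literal n, l ∉ ρ → Literal.neg l ∉ ρ →
      ∀ x ∈ insert l ρ, Literal.neg x ∉ insert l ρ := by
    intro l h1 h2 x hx hx'
    rcases mem_insert.1 hx with rfl | hx <;> rcases mem_insert.1 hx' with hx' | hx'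
    · exact hne _ hx'
    · exact h2 hx'
    · rw [← hx', Literal.neg_neg] at h2; exact h2 hx
    · exact hρ x hx hx'
  have hmeasure : ∀ l : Literal n, l ∉ ρ → 2 * n - #(insert l ρ) < N := by
    intro l h1
    have h2 : #(insert l ρ) ≤ 2 * n := by
      refine (card_le_univ _).trans (le_of_eq ?_)
      simp [mul_comm]
    rw [card_insert_of_notMem h1] at h2 ⊢
    omega
  have hsub : ∀ l, fatClauses π.toFinset d (insert l ρ) ⊆ fatClauses π.toFinset d ρ := by
    intro l D hD
    obtain ⟨h1, h2, h3⟩ := mem_filter.1 hD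
    refine mem_filter.2 ⟨h1, h2.mono_right (subset_insert _ _), h3.trans_le (card_le_card ?_)⟩
    rw [negLits_insert]
    exact sdiff_subset_sdiff (Subset.refl _) (subset_insert _ _)
  have hn0 : 0 < n := l.1.pos
  have hn : (0 : ℝ) < n := by exact_mod_cast hn0
  set q : ℝ := 1 - d / (2 * n) with hq
  have hq0 : 0 ≤ q := by
    rw [hq, sub_nonneg, div_le_one (by positivity)]
    exact_mod_cast hd
  obtain ⟨b, rfl⟩ : ∃ b', b = b' + 1 := by
    refine Nat.exists_eq_succ_of_ne_zero ?_
    rintro rfl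
    have : (1 : ℝ) ≤ #(fatClauses π.toFinset d ρ) := by exact_mod_cast card_pos.2 hfat
    simp only [pow_zero, mul_one] at hb
    linarith
  have h1 : Derives Γ (insert l ρ) (d + 1 + w₀ + b) ∅ := by
    refine ih _ (hmeasure l hlρ) b (hcons l hlρ hlρ') ?_ rfl
    have hcount : #(fatClauses π.toFinset d (insert l ρ)) +
        #{C ∈ fatClauses π.toFinset d ρ | l ∈ C \ negLits ρ} ≤ #(fatClauses π.toFinset d ρ) := by
      rw [← card_union_of_disjoint]
      · exact card_le_card (union_subset (hsub l) (filter_subset _ _))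
      · refine disjoint_left.2 fun D hD hD' => ?_
        exact disjoint_left.1 (mem_filter.1 hD).2.1 (mem_sdiff.1 (mem_filter.1 hD').2).1
          (mem_insert_self _ _)
    have hcount' : (#(fatClauses π.toFinset d (insert l ρ)) : ℝ) ≤
        #(fatClauses π.toFinset d ρ) * q := by
      have h2 : (#(fatClauses π.toFinset d (insert l ρ)) : ℝ) +
          #{C ∈ fatClauses π.toFinset d ρ | l ∈ C \ negLits ρ} ≤
            #(fatClauses π.toFinset d ρ) := by exact_mod_cast hcount
      have h3 : (d : ℝ) * #(fatClauses π.toFinset d ρ) ≤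
          2 * n * #{C ∈ fatClauses π.toFinset d ρ | l ∈ C \ negLits ρ} := by exact_mod_cast hl.le
      have h4 : (#(fatClauses π.toFinset d ρ) : ℝ) * (d / (2 * n)) ≤
          #{C ∈ fatClauses π.toFinset d ρ | l ∈ C \ negLits ρ} := by
        rw [mul_div_assoc', div_le_iff₀ (by positivity)]
        linarith
      rw [hq, mul_sub]
      linarith
    calc (#(fatClauses π.toFinset d (insert l ρ)) : ℝ) * q ^ b
        ≤ (#(fatClauses π.toFinset d ρ) * q) * q ^ b := by gcongr
      _ = #(fatClauses π.toFinset d ρ) * q ^ (b + 1) := by ring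
      _ < 1 := hb
  have h2 : Derives Γ (insert (Literal.neg l) ρ) (d + 1 + w₀ + (b + 1)) ∅ := by
    refine ih _ (hmeasure _ hlρ') (b + 1) (hcons _ hlρ' (by rwa [Literal.neg_neg])) ?_ rfl
    refine lt_of_le_of_lt ?_ hb
    gcongr
    exact hsub _
  exact Derives.of_insert hΓ (by omega) h1.insert_neg h2

end SizeWidth

/-! ### Width lower bounds -/

section Width

variable {k : ℕ} {𝒞 : Finset (Template k)} {n : ℕ}

/-- The constraints on the variables `f` that use the template `R` and are satisfied by the
values `y`. -/
def forcing (R : {R : Template k // R ∈ 𝒞}) (f : Fin k ↪ Fin n) (y : Fin k → Bool) :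
    Formula 𝒞 n :=
  R.1.image fun t => (f, fun i => y i == t i, R)

lemma card_forcing_le (R : {R : Template k // R ∈ 𝒞}) (f : Fin k ↪ Fin n) (y : Fin k → Bool) :
    #(forcing R f y) ≤ 2 ^ k := by
  refine card_image_le.trans ((card_le_univ _).trans (le_of_eq ?_))
  simp

/-- If `𝒞` is good, then `forcing R f y` has exactly the solution `y`: a solution that differs
from `y` would be a translation under which `R` is invariant. -/
lemma forcing_iff (hgood : Good 𝒞) (R : {R : Template k // R ∈ 𝒞}) (f : Fin k ↪ Fin n)
    (y : Fin k → Bool) (a : Fin n → Bool) :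
    (∀ c ∈ forcing R f y, Constr.SatBy c a) ↔ ∀ i, a (f i) = y i := by
  have hval : ∀ t : Fin k → Bool,
      Constr.SatBy ((f, fun i => y i == t i, R) : Constr 𝒞 n) a ↔
        (fun i => t i == (a (f i) == y i)) ∈ R.1 := by
    intro t
    have : (fun i => litVal a (Constr.lit ((f, fun i => y i == t i, R) : Constr 𝒞 n) i)) =
        fun i => t i == (a (f i) == y i) := by
      funext i
      simp only [litVal, Constr.lit]
      cases a (f i) <;> cases y i <;> cases t i <;> rfl
    rw [Constr.SatBy, this]
  constructor
  · intro h
    have hsub : R.1 ⊆ negate R.1 fun i => a (f i) == y i := by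
      intro t ht
      refine mem_filter.2 ⟨mem_univ _, ?_⟩
      exact (hval t).1 (h _ (mem_image_of_mem _ ht))
    have hcard : #(negate R.1 fun i => a (f i) == y i) ≤ #R.1 := by
      refine card_le_card_of_injOn (fun x i => x i == (a (f i) == y i)) ?_ ?_
      · intro x hx
        exact (mem_filter.1 hx).2
      · intro x _ x' _ hxx
        funext i
        have := congrFun hxx i
        revert this
        simp only
        cases x i <;> cases x' i <;> cases a (f i) <;> cases y i <;> simp
    have heq := eq_of_subset_of_card_le hsub hcard
    have htrue : negate R.1 (fun _ => true) = R.1 := by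
      ext x
      simp [negate]
    have := Good.negate_injective hgood R.2 (htrue.trans heq)
    intro i
    have hi := congrFun this i
    simpa using hi.symm
  · intro h c hc
    obtain ⟨t, ht, rfl⟩ := mem_image.1 hc
    rw [hval]
    simpa [h] using ht

lemma Constr.satBy_congr {c : Constr 𝒞 n} {a a' : Fin n → Bool}
    (h : ∀ x ∈ Constr.vars c, a x = a' x) : Constr.SatBy c a ↔ Constr.SatBy c a' := by
  have : (fun i => litVal a (Constr.lit c i)) = fun i => litVal a' (Constr.lit c i) := by
    funext i
    rw [litVal, litVal, show a (Constr.lit c i).1 = a' (Constr.lit c i).1 from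
      h _ (mem_image_of_mem _ (mem_univ i))]
  rw [Constr.SatBy, this, Constr.SatBy]

/-- Every assignment that satisfies the formula satisfies the clause. -/
def Formula.Implies (Ξ : Formula 𝒞 n) (C : Clause n) : Prop :=
  ∀ a : Fin n → Bool, (∀ c ∈ Ξ, Constr.SatBy c a) → ∃ l ∈ C, litVal a l = true

lemma Formula.Implies.mono {Ξ Ξ' : Formula 𝒞 n} {C C' : Clause n} (h : Formula.Implies Ξ C)
    (hΞ : Ξ ⊆ Ξ') (hC : C ⊆ C') : Formula.Implies Ξ' C' := fun a ha => by
  obtain ⟨l, hl, hv⟩ := h a fun c hc => ha c (hΞ hc)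
  exact ⟨l, hC hl, hv⟩

lemma Formula.Implies.exists_minimal {Ξ : Formula 𝒞 n} {C : Clause n}
    (h : Formula.Implies Ξ C) :
    ∃ Ξ' ⊆ Ξ, Formula.Implies Ξ' C ∧ ∀ c ∈ Ξ', ¬ Formula.Implies (Ξ'.erase c) C := by
  induction Ξ using Finset.strongInduction with
  | H Ξ ih =>
    by_cases hΞ : ∃ c ∈ Ξ, Formula.Implies (Ξ.erase c) C
    · obtain ⟨c, hc, hi⟩ := hΞ
      obtain ⟨Ξ', h1, h2⟩ := ih _ (erase_ssubset hc) hi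
      exact ⟨Ξ', h1.trans (erase_subset _ _), h2⟩
    · push Not at hΞ
      exact ⟨Ξ, Subset.refl _, h, hΞ⟩

/-- A formula that minimally implies the clause `E` becomes unsatisfiable when the literals of `E`
are forced to be false, and then all of its constraints remain necessary. Hence it is dense up to
a term linear in the width of `E`. -/
lemma Formula.Implies.dense_of_minimal (hk : 1 ≤ k) (hne : 𝒞.Nonempty) (hgood : Good 𝒞) {ε : ℝ}
    (hε : 0 < ε) (hd : DenseMinUnsat 𝒞 ε) {Ξ : Formula 𝒞 n} {E : Clause n}
    (h : Formula.Implies Ξ E) (hmin : ∀ c ∈ Ξ, ¬ Formula.Implies (Ξ.erase c) E)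
    (hn : #(Formula.vars Ξ) + #E + k ≤ n) :
    (1 + ε) * #(Formula.vars Ξ) ≤ ((k : ℝ) - 1) * (#Ξ + 2 ^ k * #E) := by
  classical
  obtain ⟨R, hR⟩ := hne
  set A := Formula.vars Ξ ∪ E.image Prod.fst with hA
  -- Fresh variables fill up the constraints that force the literals of `E`.
  obtain ⟨g, hg⟩ : ∃ g : Fin k ↪ Fin n, ∀ i, g i ∉ A := by
    have hcard : Fintype.card (Fin k) ≤ Fintype.card {x // x ∉ A} := by
      have h1 : #A ≤ #(Formula.vars Ξ) + #E :=
        (card_union_le _ _).trans (Nat.add_le_add_left card_image_le _)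
      have h2 : Fintype.card {x // x ∉ A} = n - #A := by
        rw [Fintype.card_subtype_compl]
        simp
      rw [h2, Fintype.card_fin]
      omega
    obtain ⟨g⟩ := Function.Embedding.nonempty_of_card_le hcard
    exact ⟨g.trans (Function.Embedding.subtype _), fun i => (g i).2⟩
  set i₀ : Fin k := ⟨0, hk⟩
  have hf : ∀ l : {l // l ∈ E}, ∃ f : Fin k ↪ Fin n, f i₀ = l.1.1 ∧ ∀ i, i ≠ i₀ → f i = g i := by
    rintro ⟨l, hl⟩
    have hlg : ∀ i, g i ≠ l.1 := fun i hi =>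
      hg i (hi ▸ mem_union_right _ (mem_image_of_mem _ hl))
    have hinj : Function.Injective fun i => if i = i₀ then l.1 else g i := by
      intro i j hij
      by_cases hi : i = i₀ <;> by_cases hj : j = i₀ <;>
        simp only [hi, hj, if_true, if_false] at hij ⊢
      · exact absurd hij.symm (hlg j)
      · exact absurd hij (hlg i)
      · exact g.injective hij
    refine ⟨⟨_, hinj⟩, ?_, fun i hi => show (if i = i₀ then l.1 else g i) = g i from if_neg hi⟩
    exact show (if i₀ = i₀ then l.1 else g i₀) = l.1 from if_pos rfl
  choose f hf0 hf1 using hf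
  let y : {l // l ∈ E} → Fin k → Bool := fun l i => if i = i₀ then !l.1.2 else true
  let G : Formula 𝒞 n := E.attach.biUnion fun l => forcing ⟨R, hR⟩ (f l) (y l)
  have hG : ∀ a : Fin n → Bool, (∀ c ∈ G, Constr.SatBy c a) ↔
      ∀ l : {l // l ∈ E}, ∀ i, a (f l i) = y l i := by
    intro a
    simp only [← forcing_iff hgood ⟨R, hR⟩, G, mem_biUnion, mem_attach, true_and]
    exact ⟨fun h l c hc => h c ⟨l, hc⟩, fun h c ⟨l, hc⟩ => h l c hc⟩
  have hunsat : ¬ Formula.Sat (Ξ ∪ G) := by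
    rintro ⟨a, ha⟩
    obtain ⟨l, hl, hv⟩ := h a fun c hc => ha c (mem_union_left _ hc)
    have h1 := (hG a).1 (fun c hc => ha c (mem_union_right _ hc)) ⟨l, hl⟩ i₀
    rw [hf0] at h1
    simp only [y, if_true] at h1
    simp [litVal, h1] at hv
  obtain ⟨F, hF, hFmin⟩ := Formula.exists_minUnsat_subset hunsat
  have hΞF : Ξ ⊆ F := by
    intro c hc
    by_contra hcF
    have hnot := hmin c hc
    simp only [Formula.Implies, not_forall, not_exists, not_and] at hnot
    obtain ⟨a, ha, haE⟩ := hnot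
    let a' : Fin n → Bool := fun x => if ∃ i, g i = x then true else a x
    have ha' : ∀ x ∈ A, a x = a' x := by
      intro x hx
      have : ¬ ∃ i, g i = x := by
        rintro ⟨i, rfl⟩; exact hg i hx
      simp [a', this]
    have hsatG : ∀ c ∈ G, Constr.SatBy c a' := by
      rw [hG]
      intro l i
      by_cases hi : i = i₀
      · subst hi
        rw [hf0, ← ha' _ (mem_union_right _ (mem_image_of_mem _ l.2))]
        have := haE l.1 l.2
        simp only [y, if_true]
        revert this
        simp only [litVal]
        cases a l.1.1 <;> cases l.1.2 <;> simp
      · rw [hf1 l i hi]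
        simp [y, hi, a']
    refine hFmin.1 ⟨a', fun c' hc' => ?_⟩
    rcases mem_union.1 (hF hc') with h1 | h1
    · have hne : c' ≠ c := by rintro rfl; exact hcF hc'
      refine (Constr.satBy_congr fun x hx => ?_).1 (ha c' (mem_erase.2 ⟨hne, h1⟩))
      exact ha' x (mem_union_left _ (mem_biUnion.2 ⟨c', h1, hx⟩))
    · exact hsatG c' h1
  have hGcard : #G ≤ 2 ^ k * #E := by
    refine card_biUnion_le.trans ?_
    refine (sum_le_card_nsmul _ _ (2 ^ k) fun l _ => card_forcing_le _ _ _).trans (le_of_eq ?_)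
    rw [card_attach, smul_eq_mul, mul_comm]
  have hFcard : (#F : ℝ) ≤ #Ξ + 2 ^ k * #E := by
    exact_mod_cast (card_le_card hF).trans ((card_union_le _ _).trans
      (Nat.add_le_add_left hGcard _))
  have hvars : (#(Formula.vars Ξ) : ℝ) ≤ #(Formula.lits F) := by
    exact_mod_cast (card_le_card (Formula.vars_mono hΞF)).trans (Formula.card_vars_le_card_lits F)
  have hk1 : (0 : ℝ) ≤ (k : ℝ) - 1 := by
    have : (1 : ℝ) ≤ k := by exact_mod_cast hk
    linarith
  calc (1 + ε) * (#(Formula.vars Ξ) : ℝ) ≤ (1 + ε) * #(Formula.lits F) := by gcongr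
    _ ≤ ((k : ℝ) - 1) * #F := hd n F hFmin
    _ ≤ _ := by gcongr

lemma Formula.card_vars_le (Ξ : Formula 𝒞 n) : #(Formula.vars Ξ) ≤ k * #Ξ := by
  rw [mul_comm]
  refine card_biUnion_le_card_mul _ _ _ fun c _ => ?_
  exact card_image_le.trans (by simp)

variable {cl : Template k → Finset (Clause k)}

lemma Formula.card_le_of_mem_toCNF {Φ : Formula 𝒞 n} {A : Clause n}
    (hA : A ∈ Formula.toCNF cl Φ) : #A ≤ 2 * k := by
  obtain ⟨c, -, hA⟩ := mem_biUnion.1 hA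
  obtain ⟨C, -, rfl⟩ := mem_image.1 hA
  refine card_image_le.trans ((card_le_univ _).trans (le_of_eq ?_))
  simp [mul_comm]

lemma Formula.exists_implies_of_mem_toCNF (hcl : IsCNFExpression 𝒞 cl) {Φ : Formula 𝒞 n}
    {A : Clause n} (hA : A ∈ Formula.toCNF cl Φ) :
    ∃ c ∈ Φ, Formula.Implies ({c} : Formula 𝒞 n) A := by
  obtain ⟨c, hc, hA⟩ := mem_biUnion.1 hA
  obtain ⟨C, hC, rfl⟩ := mem_image.1 hA
  refine ⟨c, hc, fun a ha => ?_⟩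
  obtain ⟨l, hl, hv⟩ := (hcl _ c.2.2.2 _).1 (ha c (mem_singleton_self c)) C hC
  refine ⟨_, mem_image_of_mem _ hl, ?_⟩
  rw [← hv]
  simp only [litVal, Constr.lit, Constr.substLit]
  cases a (c.1 l.1) <;> cases c.2.1 l.1 <;> cases l.2 <;> rfl

/-- The factor by which the number of constraints needed to imply a clause may exceed the width of
the clause, for formulas that are sparse with parameter `θ`. -/
noncomputable def widthFactor (k : ℕ) (ε θ : ℝ) : ℝ :=
  (1 + θ) * (((k : ℝ) - 1) * 2 ^ k) / (ε - θ)

lemma widthFactor_nonneg (hk : 1 ≤ k) {ε θ : ℝ} (hθ0 : 0 ≤ θ) (hθ : θ < ε) :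
    0 ≤ widthFactor k ε θ := by
  have hk1 : (0 : ℝ) ≤ (k : ℝ) - 1 := by
    have : (1 : ℝ) ≤ k := by exact_mod_cast hk
    linarith
  have : 0 < ε - θ := by linarith
  unfold widthFactor
  positivity

/-- A clause that is implied by few constraints of a sparse formula is implied by a number of them
that is at most linear in its width. -/
lemma Formula.Implies.exists_card_le (hk : 2 ≤ k) (hne : 𝒞.Nonempty) (hgood : Good 𝒞) {ε θ : ℝ}
    (hθ0 : 0 ≤ θ) (hθ : θ < ε) (hd : DenseMinUnsat 𝒞 ε) {Φ Ξ : Formula 𝒞 n} {s w : ℕ}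
    (hsp : ∀ Ξ ⊆ Φ, #Ξ ≤ s → ((k : ℝ) - 1) * #Ξ ≤ (1 + θ) * #(Formula.vars Ξ))
    (hn : k * s + w + k ≤ n) {E : Clause n} (h : Formula.Implies Ξ E) (hΞ : Ξ ⊆ Φ)
    (hs : #Ξ ≤ s) (hE : #E ≤ w) :
    ∃ Ξ' ⊆ Φ, Formula.Implies Ξ' E ∧ (#Ξ' : ℝ) ≤ widthFactor k ε θ * #E := by
  obtain ⟨Ξ', hsub, himp, hmin⟩ := h.exists_minimal
  refine ⟨Ξ', hsub.trans hΞ, himp, ?_⟩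
  have hcard : #Ξ' ≤ s := (card_le_card hsub).trans hs
  have hvars : #(Formula.vars Ξ') ≤ k * s :=
    (Formula.card_vars_le Ξ').trans (Nat.mul_le_mul_left k hcard)
  have h1 := himp.dense_of_minimal (by omega) hne hgood (hθ0.trans_lt hθ) hd hmin (by omega)
  have h2 := hsp Ξ' (hsub.trans hΞ) hcard
  have hk2 : (2 : ℝ) ≤ k := by exact_mod_cast hk
  have h3 : (#Ξ' : ℝ) ≤ (1 + θ) * #(Formula.vars Ξ') := by
    have : (0 : ℝ) ≤ #Ξ' := by positivity
    nlinarith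
  have hgap : 0 < ε - θ := by linarith
  have h4 : (#(Formula.vars Ξ') : ℝ) ≤ ((k : ℝ) - 1) * 2 ^ k * #E / (ε - θ) := by
    rw [le_div_iff₀ hgap]
    linarith
  calc (#Ξ' : ℝ) ≤ (1 + θ) * #(Formula.vars Ξ') := h3
    _ ≤ (1 + θ) * (((k : ℝ) - 1) * 2 ^ k * #E / (ε - θ)) := by gcongr
    _ = _ := by unfold widthFactor; ring

/-- In a derivation of small width, no clause needs more than `s / 2` constraints: a resolvent of
two such clauses needs at most `s` of them, and then, being narrow, at most `s / 2`. -/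
lemma Derives.exists_small_implies (hk : 2 ≤ k) (hne : 𝒞.Nonempty) (hgood : Good 𝒞) {ε θ : ℝ}
    (hθ0 : 0 ≤ θ) (hθ : θ < ε) (hd : DenseMinUnsat 𝒞 ε)
    (hcl : IsCNFExpression 𝒞 cl) {Φ : Formula 𝒞 n} {s w : ℕ}
    (hsp : ∀ Ξ ⊆ Φ, #Ξ ≤ s → ((k : ℝ) - 1) * #Ξ ≤ (1 + θ) * #(Formula.vars Ξ))
    (hn : k * s + w + k ≤ n) (hs : 2 ≤ s) (hw : 2 * (widthFactor k ε θ * w) ≤ s) {C : Clause n}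
    (h : Derives (Formula.toCNF cl Φ) ∅ w C) :
    ∃ Ξ ⊆ Φ, Formula.Implies Ξ C ∧ 2 * #Ξ ≤ s := by
  classical
  induction h with
  | ax hA _ hAC _ =>
    obtain ⟨c, hc, himp⟩ := Formula.exists_implies_of_mem_toCNF hcl hA
    refine ⟨{c}, singleton_subset_iff.2 hc, himp.mono (Subset.refl _) ?_, by simpa using hs⟩
    simpa [negLits] using hAC
  | weaken _ hCD _ ih =>
    obtain ⟨Ξ, h1, h2, h3⟩ := ih
    exact ⟨Ξ, h1, h2.mono (Subset.refl _) hCD, h3⟩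
  | @resolve C l _ _ hC ih₁ ih₂ =>
    obtain ⟨Ξ₁, h1, himp1, hc1⟩ := ih₁
    obtain ⟨Ξ₂, h2, himp2, hc2⟩ := ih₂
    have himp : Formula.Implies (Ξ₁ ∪ Ξ₂) C := by
      intro a ha
      obtain ⟨x, hx, hxv⟩ := himp1 a fun c hc => ha c (mem_union_left _ hc)
      obtain ⟨z, hz, hzv⟩ := himp2 a fun c hc => ha c (mem_union_right _ hc)
      rcases mem_insert.1 hx with rfl | hx
      · rcases mem_insert.1 hz with rfl | hz
        · exfalso
          revert hxv hzv
          simp only [litVal, Literal.neg]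
          cases a x.1 <;> cases x.2 <;> simp
        · exact ⟨z, hz, hzv⟩
      · exact ⟨x, hx, hxv⟩
    have hcard : #(Ξ₁ ∪ Ξ₂) ≤ s := (card_union_le _ _).trans (by omega)
    obtain ⟨Ξ', h3, h4, h5⟩ :=
      himp.exists_card_le hk hne hgood hθ0 hθ hd hsp hn (union_subset h1 h2) hcard hC
    refine ⟨Ξ', h3, h4, ?_⟩
    have h6 : widthFactor k ε θ * #C ≤ widthFactor k ε θ * w := by
      have := widthFactor_nonneg (k := k) (by omega) hθ0 hθ
      gcongr
    have : (2 : ℝ) * #Ξ' ≤ s := by linarith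
    exact_mod_cast this

/-- Formulas with sparse small subformulas have no narrow refutations. -/
lemma Derives.not_empty_of_sparse (hk : 2 ≤ k) (hne : 𝒞.Nonempty) (hgood : Good 𝒞) {ε θ : ℝ}
    (hθ0 : 0 ≤ θ) (hθ : θ < ε) (hd : DenseMinUnsat 𝒞 ε)
    (hcl : IsCNFExpression 𝒞 cl) {Φ : Formula 𝒞 n} {s w : ℕ}
    (hsp : ∀ Ξ ⊆ Φ, #Ξ ≤ s → ((k : ℝ) - 1) * #Ξ ≤ (1 + θ) * #(Formula.vars Ξ))
    (hn : k * s + w + k ≤ n) (hs : 2 ≤ s) (hw : 2 * (widthFactor k ε θ * w) ≤ s) :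
    ¬ Derives (Formula.toCNF cl Φ) ∅ w ∅ := by
  intro h
  obtain ⟨Ξ, h1, h2, h3⟩ := h.exists_small_implies hk hne hgood hθ0 hθ hd hcl hsp hn hs hw
  obtain ⟨Ξ', -, h4, h5⟩ := h2.exists_card_le hk hne hgood hθ0 hθ hd hsp hn h1 (by omega)
    (Nat.zero_le w)
  have h6 : Ξ' = ∅ := by
    rw [card_empty, Nat.cast_zero, mul_zero] at h5
    have : #Ξ' = 0 := by exact_mod_cast le_antisymm h5 (Nat.cast_nonneg _)
    exact card_eq_zero.1 this
  obtain ⟨l, hl, -⟩ := h4 (fun _ => true) (by simp [h6])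
  simp at hl

/-- If every refutation of narrow width is excluded, then every refutation is exponentially
long. -/
lemma two_rpow_le_length {Γ : Finset (Clause n)} {π : List (Clause n)} (hπ : IsRefutation Γ π)
    {w₀ : ℕ} (hΓ : ∀ A ∈ Γ, #A ≤ w₀) {α : ℝ} (hα : 0 < α) (hα1 : α ≤ 1) (hn : 2 ≤ α * n)
    (hnarrow : ¬ Derives Γ ∅ (⌊α * n⌋₊ + 1 + w₀ + ⌊α * n⌋₊) ∅) :
    (2 : ℝ) ^ (α ^ 2 / 8 * n) ≤ π.length := by
  by_contra! hlt
  refine hnarrow ?_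
  have hn0 : (0 : ℝ) < n := by
    by_contra! h
    nlinarith
  set d := ⌊α * n⌋₊ with hd
  have hdle : (d : ℝ) ≤ α * n := Nat.floor_le (by positivity)
  have hdge : α * n / 2 ≤ d := by
    have := Nat.lt_floor_add_one (α * n)
    rw [← hd] at this
    linarith
  have hdn : (d : ℝ) ≤ n := hdle.trans (mul_le_of_le_one_left hn0.le hα1)
  have hdn' : d ≤ n := by exact_mod_cast hdn
  refine Derives.empty_of_isRefutation hπ hΓ (by omega) d (by simp) ?_
  have hfat : (#(fatClauses π.toFinset d ∅) : ℝ) ≤ π.length := by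
    exact_mod_cast (card_le_card (filter_subset _ _)).trans (List.toFinset_card_le π)
  have hx1 : α / 4 ≤ (d : ℝ) / (2 * n) := by
    rw [le_div_iff₀ (by positivity)]
    linarith
  have hq0 : (0 : ℝ) ≤ 1 - d / (2 * n) := by
    rw [sub_nonneg, div_le_one (by positivity)]
    linarith
  have hq : (1 - (d : ℝ) / (2 * n)) ^ d ≤ Real.exp (-(α ^ 2 / 8 * n)) := by
    calc (1 - (d : ℝ) / (2 * n)) ^ d ≤ Real.exp (-(α / 4)) ^ d := by
          refine pow_le_pow_left₀ hq0 ?_ _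
          have := Real.add_one_le_exp (-(α / 4))
          linarith
      _ = Real.exp (-(d * (α / 4))) := by rw [← Real.exp_nat_mul]; congr 1; ring
      _ ≤ _ := by
          refine Real.exp_le_exp.2 ?_
          nlinarith
  have hlen : (π.length : ℝ) < Real.exp (α ^ 2 / 8 * n) := by
    refine hlt.trans_le ?_
    rw [Real.rpow_def_of_pos (by norm_num)]
    refine Real.exp_le_exp.2 ?_
    have h1 : Real.log 2 ≤ 1 := by
      have := Real.log_le_sub_one_of_pos (show (0 : ℝ) < 2 by norm_num)
      linarith
    have h2 : 0 ≤ α ^ 2 / 8 * n := by positivity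
    nlinarith
  calc (#(fatClauses π.toFinset d ∅) : ℝ) * (1 - d / (2 * n)) ^ d
      ≤ π.length * Real.exp (-(α ^ 2 / 8 * n)) := by gcongr
    _ < Real.exp (α ^ 2 / 8 * n) * Real.exp (-(α ^ 2 / 8 * n)) := by gcongr
    _ = 1 := by rw [← Real.exp_add]; simp

lemma ofReal_le_resolutionComplexity {Γ : Finset (Clause n)} {x : ℝ}
    (h : ∀ π, IsRefutation Γ π → x ≤ (π.length : ℝ)) :
    ENNReal.ofReal x ≤ ((resolutionComplexity Γ : ℕ∞) : ENNReal) := by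
  have h1 : ((⌈x⌉₊ : ℕ) : ℕ∞) ≤ resolutionComplexity Γ :=
    le_iInf₂ fun π hπ => by exact_mod_cast Nat.ceil_le.2 (h π hπ)
  calc ENNReal.ofReal x ≤ ENNReal.ofReal (⌈x⌉₊ : ℝ) := ENNReal.ofReal_le_ofReal (Nat.le_ceil x)
    _ = (((⌈x⌉₊ : ℕ) : ℕ∞) : ENNReal) := by simp
    _ ≤ _ := by exact_mod_cast h1

/-- Random formulas are sparse, sparse formulas have no narrow refutations, and hence no short
ones. -/
theorem exponentialResolutionComplexity_of_dense (hk : 2 ≤ k) (hne : 𝒞.Nonempty)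
    (hgood : Good 𝒞) {ε : ℝ} (hε : 0 < ε) (hd : DenseMinUnsat 𝒞 ε) :
    ExponentialResolutionComplexity 𝒞 := by
  intro cl hcl c hc
  have hk2 : (2 : ℝ) ≤ k := by exact_mod_cast hk
  set θ : ℝ := min (ε / 2) 1 with hθ
  have hθ0 : 0 < θ := by positivity
  have hθε : θ < ε := (min_le_left _ _).trans_lt (by linarith)
  obtain ⟨η, hη, hη1, B, hB⟩ := exists_pr_not_sparse_le (𝒞 := 𝒞) hk hne hθ0 (min_le_right _ _) hc
  set κ : ℝ := widthFactor k ε θ with hκ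
  have hκ0 : 0 ≤ κ := widthFactor_nonneg (by omega) hθ0.le hθε
  -- The width `2 α n + O(1)` has to be small compared with the number `η n / (2 k)` of constraints
  -- up to which sparseness is used.
  set α : ℝ := min (1 / 16) (η / (16 * k * (κ + 1))) with hα
  have hα0 : 0 < α := by positivity
  have hα1 : α ≤ 1 / 16 := min_le_left _ _
  have hα2 : 4 * κ * α ≤ η / (4 * k) := by
    have h1 : α ≤ η / (16 * k * (κ + 1)) := min_le_right _ _
    rw [le_div_iff₀ (by positivity)] at h1 ⊢
    nlinarith [mul_pos hα0 (show (0 : ℝ) < k by linarith)]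
  refine ⟨α ^ 2 / 8, by positivity, fun m hm => ?_⟩
  refine tendsto_prob_one (u := fun n : ℕ => B * (n : ℝ) ^ (-θ)) hne ?_ ?_
  · simpa using ((tendsto_rpow_neg_atTop hθ0).comp tendsto_natCast_atTop_atTop).const_mul B
  have hlarge : ∀ x : ℝ, ∀ᶠ n : ℕ in atTop, x ≤ n := fun x =>
    tendsto_natCast_atTop_atTop.eventually_ge_atTop x
  filter_upwards [eventually_ge_atTop k, hlarge (2 / α), hlarge (4 * (1 + 3 * k)),
    hlarge ((2 * κ * (1 + 2 * k) + 3) / (η / (4 * k)))] with n hkn hn1 hn2 hn3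
  refine (pr_mono fun ω hω hsp => hω ?_).trans (hB n hkn (m n) univ (by simpa using hm n))
  have hn0 : (0 : ℝ) < n := by exact_mod_cast (by omega : 0 < n)
  rw [div_le_iff₀ (by positivity)] at hn1 hn3
  refine ofReal_le_resolutionComplexity fun π hπ => ?_
  refine two_rpow_le_length hπ (w₀ := 2 * k) (fun A hA => Formula.card_le_of_mem_toCNF hA) hα0
    (by linarith) (by linarith) ?_
  set d := ⌊α * n⌋₊ with hddef
  have hdle : (d : ℝ) ≤ α * n := Nat.floor_le (by positivity)
  set s := ⌊η * n / (2 * k)⌋₊ with hsdef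
  have hsle : (s : ℝ) ≤ η * n / (2 * k) := Nat.floor_le (by positivity)
  have hsge : η * n / (2 * k) - 1 ≤ s := by
    have := Nat.lt_floor_add_one (η * n / (2 * k))
    rw [← hsdef] at this
    linarith
  have hks : (k : ℝ) * s ≤ η * n / 2 := by
    calc (k : ℝ) * s ≤ k * (η * n / (2 * k)) := by gcongr
      _ = _ := by field_simp
  have hsplit : η * n / (2 * k) = n * (η / (4 * k)) + n * (η / (4 * k)) := by
    field_simp; ring
  have hκk : 0 ≤ κ * k := by positivity
  have hs2 : (2 : ℝ) ≤ s := by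
    have : 0 ≤ n * (η / (4 * k)) := by positivity
    nlinarith
  refine Derives.not_empty_of_sparse hk hne hgood hθ0.le hθε hd hcl (s := s) ?_ ?_ ?_ ?_
  · intro Ξ hΞ hΞs
    refine hsp Ξ hΞ ?_
    have h1 : (#(Formula.vars Ξ) : ℝ) ≤ k * s := by
      exact_mod_cast (Formula.card_vars_le Ξ).trans (Nat.mul_le_mul_left k hΞs)
    have h2 : 0 ≤ η * n := by positivity
    linarith
  · have h1 : η * n ≤ n := mul_le_of_le_one_left hn0.le hη1
    have h2 : α * n ≤ 1 / 16 * n := by gcongr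
    have h3 : (k : ℝ) * s + (d + 1 + 2 * k + d) + k ≤ n := by linarith
    exact_mod_cast h3
  · exact_mod_cast hs2
  · rw [← hκ]
    push_cast
    have h1 : κ * d ≤ κ * (α * n) := by gcongr
    have h2 : 4 * κ * α * n ≤ η / (4 * k) * n := by gcongr
    linarith

end Width

end NegSAT

theorem mainTheorem4 (k : ℕ) (hk : 2 ≤ k) (𝒞 : Finset (NegSAT.Template k)) (hne : 𝒞.Nonempty)
    (hgood : NegSAT.Good 𝒞) (hsharp : NegSAT.SharpThreshold 𝒞)
    (hdense : ∃ ε : ℝ, 0 < ε ∧ ∀ (n : ℕ) (F : NegSAT.Formula 𝒞 n),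
      NegSAT.Formula.MinUnsat F →
        (1 + ε) / ((k : ℝ) - 1) ≤ (F.card : ℝ) / ((NegSAT.Formula.lits F).card : ℝ)) :
    (∃ δ : ℝ, 0 < δ ∧ ∀ m : ℕ → ℕ,
      (∀ n, (m n : ℝ) ≤ 2 / ((k : ℝ) * ((k : ℝ) - 1)) * (1 + δ) * n) →
        Filter.Tendsto (fun n => NegSAT.prob 𝒞 n (m n) fun Φ => NegSAT.Formula.Sat Φ)
          Filter.atTop (nhds 1)) ∧
    NegSAT.DiscontinuousSpine 𝒞 ∧
    NegSAT.ExponentialResolutionComplexity 𝒞 := by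
  obtain ⟨ε, hε, hdense⟩ := hdense
  have hk1 : (0 : ℝ) < (k : ℝ) - 1 := by
    have : (2 : ℝ) ≤ k := by exact_mod_cast hk
    linarith
  have hd : NegSAT.DenseMinUnsat 𝒞 ε := by
    intro n F hF
    have h := hdense n F hF
    rcases Nat.eq_zero_or_pos (NegSAT.Formula.lits F).card with h0 | h0
    · rw [h0, Nat.cast_zero, mul_zero]
      positivity
    · rw [div_le_div_iff₀ hk1 (by exact_mod_cast h0)] at h
      linarith
  exact ⟨NegSAT.exists_tendsto_prob_sat hk hne hε hd,
    NegSAT.discontinuousSpine_of_dense hk hne hgood hε hd,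
    NegSAT.exponentialResolutionComplexity_of_dense hk hne hgood hε hd⟩
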